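/- **Theorem.** Let $G=\mathbb{Z}_{2^k}\times\mathbb{Z}_2$ with $k\ge 1$, let $S$ be a proper subset of $G\setminus\{0\}$ that generates $G$, put $S_0=S\cup\{0\}$, and let $0\in C\subseteq G$. Let $\mathrm{Cay}(G,S)$ be the directed graph with vertex set $G$ and an arc from $x$ to $y$ if and only if $y-x\in S$; call $C$ a perfect code in it if for every $v\in G$ there is exactly one $u\in C$ such that $u=v$ or there is an arc from $u$ to $v$. Write $[N]=\{0,1,\dots,N-1\}$. Then $C$ is a perfect code in $\mathrm{Cay}(G,S)$ if and only if there are integers $n\ge 1$, $r\in[n]$, $0=m_0,m_1,\dots,m_n=k$ and $l_0,\dots,l_{n-1}$ with $m_t<m_{t+1}$ and $1\le l_t\le m_{t+1}-m_t$ for $t\in[n]\setminus\{r\}$, with $m_r\le m_{r+1}$ and $0\le l_r\le m_{r+1}-m_r$, and with $m_r<m_{r+1}$ unless the pair is of type (d) or (e), such that $(S_0,C)$ is one of the following pairs. Here the $\alpha_{i_0,\dots,i_t}$, $\beta_{i_0,\dots,i_t}$, $\alpha_{i_0,\dots,i_t,j}$, $\beta_{i_0,\dots,i_t,j}$ and $\gamma_{i_0,\dots,i_t}$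 are integers, depending only on their indices, and every $\alpha$ or $\beta$ whose indices are all $0$ is $0$. If $r=0$, then $[n]\setminus\{r-1\}$ means $[n]$, and $\beta_{i_0,\dots,i_{r-1}}$ and $\gamma_{i_0,\dots,i_{r-1}}$ have no index (so this $\beta$ is $0$ and this $\gamma$ is a constant). (a) where $m_r+l_r=m_{r+1}$: $$S_0=\Big\{\Big(\sum_{t=0}^{n-1}i_t2^{m_t}+\sum_{t\in[n]\setminus\{r\}}\alpha_{i_0,\dots,i_t}2^{m_t+l_t},\ \alpha_{i_0,\dots,i_r}\Big)\ \Big|\ i_t\in[2^{l_t}]\Big\},$$ $$C=\Big\{\Big(\sum_{t\in[n]\setminus\{r\}}i_t2^{m_t+l_t}+\sum_{t=0}^{n-1}\beta_{i_0,\dots,i_t}2^{m_{t+1}},\ i_r\Big)\ \Big|\ i_t\in[2^{m_{t+1}-m_t-l_t}]\text{ for }t\ne r,\ i_r\in[2]\Big\}.$$ (b) where $m_r+l_r\ge 1$: $$S_0=\Big\{\Big(\sum_{t=0}^{n-1}i_t2^{m_t}+\sum_{t\in[n]\setminus\{r\}}\alpha_{i_0,\dots,i_t}2^{m_t+l_t}+\alpha_{i_0,\dots,i_r}2^{m_r+l_r-1},\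 \alpha_{i_0,\dots,i_r}\Big)\ \Big|\ i_t\in[2^{l_t}]\Big\},$$ $$C=\Big\{\Big(\sum_{t\in[n]\setminus\{r\}}i_t2^{m_t+l_t}+\sum_{t=0}^{n-1}\beta_{i_0,\dots,i_t}2^{m_{t+1}}+i_r2^{m_r+l_r-1},\ i_r\Big)\ \Big|\ i_t\in[2^{m_{t+1}-m_t-l_t}]\text{ for }t\ne r,\ i_r\in[2^{m_{r+1}-m_r-l_r+1}]\Big\}.$$ (c) $$S_0=\Big\{\Big(\sum_{t=0}^{n-1}\big(i_t2^{m_t}+\alpha_{i_0,\dots,i_t}2^{m_t+l_t}\big),\ \gamma_{i_0,\dots,i_r}\Big)\ \Big|\ i_t\in[2^{l_t}]\Big\},$$ $$C=\Big\{\Big(\sum_{t=0}^{n-1}i_t2^{m_t+l_t}+\sum_{t=0}^{r-1}\beta_{i_0,\dots,i_t}2^{m_{t+1}}+\sum_{t=r}^{n-1}\beta_{i_0,\dots,i_t,j}2^{m_{t+1}},\ j\Big)\ \Big|\ i_t\in[2^{m_{t+1}-m_t-l_t}],\ j\in[2]\Big\}.$$ (d) where $l_r=0$: $$S_0=\Big\{\Big(\sum_{t\in[n]\setminus\{r\}}i_t2^{m_t}+\sum_{t=0}^{n-1}\alpha_{i_0,\dots,i_t}2^{m_t+l_t},\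 i_r\Big)\ \Big|\ i_t\in[2^{l_t}]\text{ for }t\ne r,\ i_r\in[2]\Big\},$$ $$C=\Big\{\Big(\sum_{t=0}^{n-1}i_t2^{m_t+l_t}+\sum_{t\in[n]\setminus\{r-1\}}\beta_{i_0,\dots,i_t}2^{m_{t+1}},\ \beta_{i_0,\dots,i_{r-1}}\Big)\ \Big|\ i_t\in[2^{m_{t+1}-m_t-l_t}]\Big\}.$$ (e) where $r\ge 1$: $$S_0=\Big\{\Big(\sum_{t\in[n]\setminus\{r\}}i_t2^{m_t}+\sum_{t=0}^{n-1}\alpha_{i_0,\dots,i_t}2^{m_t+l_t}+i_r2^{m_r-1},\ i_r\Big)\ \Big|\ i_t\in[2^{l_t}]\text{ for }t\ne r,\ i_r\in[2^{l_r+1}]\Big\},$$ $$C=\Big\{\Big(\sum_{t=0}^{n-1}i_t2^{m_t+l_t}+\sum_{t\in[n]\setminus\{r-1\}}\beta_{i_0,\dots,i_t}2^{m_{t+1}}+\beta_{i_0,\dots,i_{r-1}}2^{m_r-1},\ \beta_{i_0,\dots,i_{r-1}}\Big)\ \Big|\ i_t\in[2^{m_{t+1}-m_t-l_t}]\Big\}.$$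 (f) $$S_0=\Big\{\Big(\sum_{t=0}^{n-1}i_t2^{m_t}+\sum_{t=0}^{r-1}\alpha_{i_0,\dots,i_t}2^{m_t+l_t}+\sum_{t=r}^{n-1}\alpha_{i_0,\dots,i_t,j}2^{m_t+l_t},\ j\Big)\ \Big|\ i_t\in[2^{l_t}],\ j\in[2]\Big\},$$ $$C=\Big\{\Big(\sum_{t=0}^{n-1}\big(i_t2^{m_t+l_t}+\beta_{i_0,\dots,i_t}2^{m_{t+1}}\big),\ \gamma_{i_0,\dots,i_{r-1}}\Big)\ \Big|\ i_t\in[2^{m_{t+1}-m_t-l_t}]\Big\}.$$ -/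

import Mathlib

open Finset

/-- The directed Cayley graph of an additive group: there is an arc from `x` to `y` if and only if
`y - x ∈ S`.  (Mathlib's `SimpleGraph.addCayley` is the symmetrized, undirected version.) -/
def cayleyDigraph {G : Type*} [AddGroup G] (S : Set G) : Digraph G where
  Adj x y := y - x ∈ S

/-- A perfect code (perfect 1-code) in a directed graph: every vertex `v` is at directed distance
at most one from exactly one vertex `u ∈ C`. -/
def IsPerfectCode {V : Type*} (Γ : Digraph V) (C : Set V) : Prop :=
  ∀ v : V, ∃! u : V, u ∈ C ∧ (u = v ∨ Γ.Adj u v)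

/-- The element of `ℤ_{2^k} × ℤ_2` represented by the integers `x` and `y`. -/
def toG (k : ℕ) (x y : ℤ) : ZMod (2 ^ k) × ZMod 2 := ((x : ZMod (2 ^ k)), (y : ZMod 2))

/-- The tuple `(i_0, …, i_{s-1})` of the first `s` entries of a sequence `i`. -/
def pre (i : ℕ → ℕ) (s : ℕ) : List ℕ := (List.range s).map i

/-- A family of integers indexed by finite tuples of natural numbers is normalized if it vanishes
at every tuple `(0, …, 0)`. -/
def IsNormalized (α : List ℕ → ℤ) : Prop := ∀ s : ℕ, α (List.replicate s 0) = 0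

/-- The numerical data `n, r, m_0, …, m_n, l_0, …, l_{n-1}`: `r ∈ [n]`, `m_0 = 0`, `m_n = k`,
`m_t < m_{t+1}` and `1 ≤ l_t ≤ m_{t+1} - m_t` for `t ∈ [n] \ {r}`, and `0 ≤ l_r ≤ m_{r+1} - m_r`
(in particular `m_r ≤ m_{r+1}`). -/
def IsLevelData (k n r : ℕ) (m l : ℕ → ℕ) : Prop :=
  r < n ∧ m 0 = 0 ∧ m n = k ∧
    (∀ t < n, t ≠ r → m t < m (t + 1) ∧ 1 ≤ l t) ∧
    (∀ t < n, m t + l t ≤ m (t + 1))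

/-- Family (a). -/
def FamilyA (k n r : ℕ) (m l : ℕ → ℕ) (S₀ C : Set (ZMod (2 ^ k) × ZMod 2)) : Prop :=
  m r < m (r + 1) ∧ m r + l r = m (r + 1) ∧
  ∃ α β : List ℕ → ℤ, IsNormalized α ∧ IsNormalized β ∧
    S₀ = {g | ∃ i : ℕ → ℕ, (∀ t < n, i t < 2 ^ l t) ∧
      g = toG k
        (∑ t ∈ range n, (i t : ℤ) * 2 ^ m t
          + ∑ t ∈ (range n).erase r, α (pre i (t + 1)) * 2 ^ (m t + l t))
        (α (pre i (r + 1)))} ∧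
    C = {g | ∃ i : ℕ → ℕ,
      (∀ t < n, t ≠ r → i t < 2 ^ (m (t + 1) - m t - l t)) ∧ i r < 2 ∧
      g = toG k
        (∑ t ∈ (range n).erase r, (i t : ℤ) * 2 ^ (m t + l t)
          + ∑ t ∈ range n, β (pre i (t + 1)) * 2 ^ m (t + 1))
        (i r)}

/-- Family (b); the exponent `m_r + l_r - 1` has to be nonnegative. -/
def FamilyB (k n r : ℕ) (m l : ℕ → ℕ) (S₀ C : Set (ZMod (2 ^ k) × ZMod 2)) : Prop :=
  m r < m (r + 1) ∧ 1 ≤ m r + l r ∧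
  ∃ α β : List ℕ → ℤ, IsNormalized α ∧ IsNormalized β ∧
    S₀ = {g | ∃ i : ℕ → ℕ, (∀ t < n, i t < 2 ^ l t) ∧
      g = toG k
        (∑ t ∈ range n, (i t : ℤ) * 2 ^ m t
          + ∑ t ∈ (range n).erase r, α (pre i (t + 1)) * 2 ^ (m t + l t)
          + α (pre i (r + 1)) * 2 ^ (m r + l r - 1))
        (α (pre i (r + 1)))} ∧
    C = {g | ∃ i : ℕ → ℕ,
      (∀ t < n, t ≠ r → i t < 2 ^ (m (t + 1) - m t - l t)) ∧
      i r < 2 ^ (m (r + 1) - m r - l r + 1) ∧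
      g = toG k
        (∑ t ∈ (range n).erase r, (i t : ℤ) * 2 ^ (m t + l t)
          + ∑ t ∈ range n, β (pre i (t + 1)) * 2 ^ m (t + 1)
          + (i r : ℤ) * 2 ^ (m r + l r - 1))
        (i r)}

/-- Family (c). -/
def FamilyC (k n r : ℕ) (m l : ℕ → ℕ) (S₀ C : Set (ZMod (2 ^ k) × ZMod 2)) : Prop :=
  m r < m (r + 1) ∧
  ∃ α β γ : List ℕ → ℤ, IsNormalized α ∧ IsNormalized β ∧
    S₀ = {g | ∃ i : ℕ → ℕ, (∀ t < n, i t < 2 ^ l t) ∧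
      g = toG k
        (∑ t ∈ range n, ((i t : ℤ) * 2 ^ m t + α (pre i (t + 1)) * 2 ^ (m t + l t)))
        (γ (pre i (r + 1)))} ∧
    C = {g | ∃ (i : ℕ → ℕ) (j : ℕ),
      (∀ t < n, i t < 2 ^ (m (t + 1) - m t - l t)) ∧ j < 2 ∧
      g = toG k
        (∑ t ∈ range n, (i t : ℤ) * 2 ^ (m t + l t)
          + ∑ t ∈ range r, β (pre i (t + 1)) * 2 ^ m (t + 1)
          + ∑ t ∈ Ico r n, β (pre i (t + 1) ++ [j]) * 2 ^ m (t + 1))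
        j}

/-- Family (d).  The sum over `[n] \ {r - 1}` is over all of `[n]` if `r = 0`, and then
`β_{i_0,…,i_{r-1}}` is the value of `β` at the empty tuple. -/
def FamilyD (k n r : ℕ) (m l : ℕ → ℕ) (S₀ C : Set (ZMod (2 ^ k) × ZMod 2)) : Prop :=
  l r = 0 ∧
  ∃ α β : List ℕ → ℤ, IsNormalized α ∧ IsNormalized β ∧
    S₀ = {g | ∃ i : ℕ → ℕ, (∀ t < n, t ≠ r → i t < 2 ^ l t) ∧ i r < 2 ∧
      g = toG k
        (∑ t ∈ (range n).erase r, (i t : ℤ) * 2 ^ m t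
          + ∑ t ∈ range n, α (pre i (t + 1)) * 2 ^ (m t + l t))
        (i r)} ∧
    C = {g | ∃ i : ℕ → ℕ, (∀ t < n, i t < 2 ^ (m (t + 1) - m t - l t)) ∧
      g = toG k
        (∑ t ∈ range n, (i t : ℤ) * 2 ^ (m t + l t)
          + ∑ t ∈ (range n).filter (fun t => t + 1 ≠ r), β (pre i (t + 1)) * 2 ^ m (t + 1))
        (β (pre i r))}

/-- Family (e); the exponent `m_r - 1` has to be nonnegative, that is, `r ≥ 1`. -/
def FamilyE (k n r : ℕ) (m l : ℕ → ℕ) (S₀ C : Set (ZMod (2 ^ k) × ZMod 2)) : Prop :=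
  1 ≤ r ∧
  ∃ α β : List ℕ → ℤ, IsNormalized α ∧ IsNormalized β ∧
    S₀ = {g | ∃ i : ℕ → ℕ, (∀ t < n, t ≠ r → i t < 2 ^ l t) ∧ i r < 2 ^ (l r + 1) ∧
      g = toG k
        (∑ t ∈ (range n).erase r, (i t : ℤ) * 2 ^ m t
          + ∑ t ∈ range n, α (pre i (t + 1)) * 2 ^ (m t + l t)
          + (i r : ℤ) * 2 ^ (m r - 1))
        (i r)} ∧
    C = {g | ∃ i : ℕ → ℕ, (∀ t < n, i t < 2 ^ (m (t + 1) - m t - l t)) ∧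
      g = toG k
        (∑ t ∈ range n, (i t : ℤ) * 2 ^ (m t + l t)
          + ∑ t ∈ (range n).filter (fun t => t + 1 ≠ r), β (pre i (t + 1)) * 2 ^ m (t + 1)
          + β (pre i r) * 2 ^ (m r - 1))
        (β (pre i r))}

/-- Family (f). If `r = 0`, then `γ_{i_0,…,i_{r-1}}` is the value of `γ` at the empty tuple. -/
def FamilyF (k n r : ℕ) (m l : ℕ → ℕ) (S₀ C : Set (ZMod (2 ^ k) × ZMod 2)) : Prop :=
  m r < m (r + 1) ∧
  ∃ α β γ : List ℕ → ℤ, IsNormalized α ∧ IsNormalized β ∧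
    S₀ = {g | ∃ (i : ℕ → ℕ) (j : ℕ), (∀ t < n, i t < 2 ^ l t) ∧ j < 2 ∧
      g = toG k
        (∑ t ∈ range n, (i t : ℤ) * 2 ^ m t
          + ∑ t ∈ range r, α (pre i (t + 1)) * 2 ^ (m t + l t)
          + ∑ t ∈ Ico r n, α (pre i (t + 1) ++ [j]) * 2 ^ (m t + l t))
        j} ∧
    C = {g | ∃ i : ℕ → ℕ, (∀ t < n, i t < 2 ^ (m (t + 1) - m t - l t)) ∧
      g = toG k
        (∑ t ∈ range n, ((i t : ℤ) * 2 ^ (m t + l t) + β (pre i (t + 1)) * 2 ^ m (t + 1)))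
        (γ (pre i r))}

/-! A perfect code is a tiling: every element of `G` is uniquely `s + u` with `s ∈ S₀` and `u ∈ C`.
Pulled back to `ℤ × ℤ`, this is a tiling modulo `latL k`, and the relevant subgroups become explicit
lattices.

The heart of the matter is that one factor of a tiling of `ℤ_{2^(q+1)}` or `ℤ_{2^(q+1)} × ℤ_2` has a
period of order two. The sum of a nontrivial character over the group is zero and is the product of
its sums over the factors, so one of these vanishes; a rational combination of `2^(q+1)`-th roots of
unity vanishes only if its coefficients are invariant under the shift by `2^q`
(`periodic_of_sum_pow_eq_zero`). One faithful character settles the cyclic case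
(`TilesMod.periodic_zmod`), two characters with different kernels the other
(`TilesMod.exists_period`). Dividing by the period leaves a tiling, so iteration gives a chain of
steps of index two, `⊤ = latB c 0 > ⋯ > latB c d > latL d > ⋯ > latL k`, at each of which one set is
invariant and the other rigid (`TilesMod.exists_steps`).

Conversely, such a chain forces a tiling (`tilesMod_of_chain`). A set alternately invariant and
rigid along a chain is a set of digit sums: digits are free at its own steps, and at the others a
correction depends on the digits already chosen (`adapted_of_digits`, `exists_digits`).

The families record the value of `c` and the owner of the exceptional step from `latB` to `latL`:
`C` in (a)–(c), `S₀` in (d)–(f). To describe a given tiling, each ordinary step of `S₀` is made a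
level with `l_t = 1`; then (b)–(e) suffice, and generation by `S` guarantees that the chain begins
with `S₀`. -/

/-! ### Tilings modulo a subgroup, chains of steps, and digit expansions -/

section Tilings

variable {Γ : Type*} [AddCommGroup Γ]

/-- The sums `a + b` with `a ∈ A` and `b ∈ B` represent every class modulo `H` exactly once. -/
def TilesMod (H : AddSubgroup Γ) (A B : Set Γ) : Prop :=
  (∀ g, ∃ a ∈ A, ∃ b ∈ B, g - (a + b) ∈ H) ∧
    ∀ a ∈ A, ∀ a' ∈ A, ∀ b ∈ B, ∀ b' ∈ B, (a + b) - (a' + b') ∈ H → a - a' ∈ H ∧ b - b' ∈ H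

/-- Modulo `H'`, the set `A` is invariant under translation by `H`. -/
def Owned (A : Set Γ) (H H' : AddSubgroup Γ) : Prop :=
  ∀ a ∈ A, ∀ h ∈ H, ∃ a' ∈ A, a' - a - h ∈ H'

/-- Elements of `A` that agree modulo `H` agree modulo `H'`. -/
def Rigid (A : Set Γ) (H H' : AddSubgroup Γ) : Prop :=
  ∀ a ∈ A, ∀ a' ∈ A, a - a' ∈ H → a - a' ∈ H'

/-- The step from `H` to `H'` belongs to `A`: there `A` is invariant, and `B` is rigid. -/
def StepBy (A B : Set Γ) (H H' : AddSubgroup Γ) : Prop := Owned A H H' ∧ Rigid B H H'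

/-- The step from `H` to `H'` belongs to `A` or to `B`. -/
def Step (A B : Set Γ) (H H' : AddSubgroup Γ) : Prop := StepBy A B H H' ∨ StepBy B A H H'

variable {A B : Set Γ} {H H' H'' : AddSubgroup Γ}

theorem Step.symm (h : Step A B H H') : Step B A H H' := Or.symm h

theorem TilesMod.symm (h : TilesMod H A B) : TilesMod H B A := by
  refine ⟨fun g => ?_, fun b hb b' hb' a ha a' ha' hab => ?_⟩
  · obtain ⟨a, ha, b, hb, hab⟩ := h.1 g
    exact ⟨b, hb, a, ha, by rwa [add_comm b a]⟩
  · exact (h.2 a ha a' ha' b hb b' hb' (by rwa [add_comm a, add_comm a'])).symm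

theorem TilesMod.nonempty_left (h : TilesMod H A B) : A.Nonempty := by
  obtain ⟨a, ha, -⟩ := h.1 0
  exact ⟨a, ha⟩

theorem Owned.refl : Owned A H H := fun a ha h hh => ⟨a, ha, by simpa using hh⟩

theorem Rigid.refl : Rigid A H H := fun _ _ _ _ h => h

theorem Owned.trans (h₁ : Owned A H H') (h₂ : Owned A H' H'') : Owned A H H'' := by
  intro a ha h hh
  obtain ⟨a₁, ha₁, h1⟩ := h₁ a ha h hh
  obtain ⟨a₂, ha₂, h2⟩ := h₂ a₁ ha₁ _ (H'.neg_mem h1)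
  exact ⟨a₂, ha₂, by convert h2 using 1; abel⟩

theorem Rigid.trans (h₁ : Rigid A H H') (h₂ : Rigid A H' H'') : Rigid A H H'' :=
  fun a ha a' ha' h => h₂ a ha a' ha' (h₁ a ha a' ha' h)

theorem StepBy.trans (h₁ : StepBy A B H H') (h₂ : StepBy A B H' H'') : StepBy A B H H'' :=
  ⟨h₁.1.trans h₂.1, h₁.2.trans h₂.2⟩

theorem StepBy.chain (X : ℕ → AddSubgroup Γ) {p q : ℕ} (hpq : p ≤ q)
    (h : ∀ s, p ≤ s → s < q → StepBy A B (X s) (X (s + 1))) : StepBy A B (X p) (X q) := by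
  induction q, hpq using Nat.le_induction with
  | base => exact ⟨Owned.refl, Rigid.refl⟩
  | succ q hq ih => exact (ih fun s h1 h2 => h s h1 (by omega)).trans (h q hq (by omega))

/-- If two sums agree modulo `H` but differ by `κ` modulo `H'`, moving one summand by `κ` inside `A`
makes them agree modulo `H'`, where uniqueness applies. -/
theorem TilesMod.of_period (hT : TilesMod H' A B) (hle : H' ≤ H) (κ : Γ)
    (h2 : ∀ h ∈ H, h ∈ H' ∨ h - κ ∈ H') (hκ : κ ∈ H) (hA : ∀ a ∈ A, ∃ a' ∈ A, a' - a - κ ∈ H') :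
    Owned A H H' ∧ Rigid B H H' ∧ TilesMod H A B := by
  have key : ∀ a ∈ A, ∀ a' ∈ A, ∀ b ∈ B, ∀ b' ∈ B, (a + b) - (a' + b') ∈ H →
      a - a' ∈ H ∧ b - b' ∈ H' := by
    intro a ha a' ha' b hb b' hb' h
    rcases h2 _ h with h | h
    · exact ⟨hle (hT.2 a ha a' ha' b hb b' hb' h).1, (hT.2 a ha a' ha' b hb b' hb' h).2⟩
    · obtain ⟨a₁, ha₁, h1⟩ := hA a' ha'
      have := hT.2 a ha a₁ ha₁ b hb b' hb' (by
        convert H'.sub_mem h h1 using 1; abel)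
      refine ⟨?_, this.2⟩
      convert H.add_mem (H.add_mem (hle this.1) (hle h1)) hκ using 1
      abel
  refine ⟨fun a ha h hh => ?_, fun b hb b' hb' h => ?_, fun g => ?_, ?_⟩
  · rcases h2 h hh with h' | h'
    · exact ⟨a, ha, by simpa using h'⟩
    · obtain ⟨a₁, ha₁, h1⟩ := hA a ha
      exact ⟨a₁, ha₁, by convert H'.sub_mem h1 h' using 1; abel⟩
  · obtain ⟨a, ha⟩ := hT.nonempty_left
    exact (key a ha a ha b hb b' hb' (by simpa using h)).2
  · obtain ⟨a, ha, b, hb, h⟩ := hT.1 g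
    exact ⟨a, ha, b, hb, hle h⟩
  · intro a ha a' ha' b hb b' hb' h
    have := key a ha a' ha' b hb b' hb' h
    exact ⟨this.1, hle this.2⟩

/-- Induction along the chain. An error in `U n` is pushed into `V n` by moving `a`, then into `U (n
+ 1)` by moving `b`. For uniqueness, rigidity of `B` puts `b - b'` into `V n`, hence also `a - a'`,
and rigidity of `A` finishes. -/
theorem tilesMod_of_chain {n : ℕ} {U V : ℕ → AddSubgroup Γ} (hU : U 0 = ⊤)
    (hVU : ∀ t < n, V t ≤ U t) (hUV : ∀ t < n, U (t + 1) ≤ V t)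
    (hA : A.Nonempty) (hB : B.Nonempty)
    (hA1 : ∀ t < n, Owned A (U t) (V t)) (hA2 : ∀ t < n, Rigid A (V t) (U (t + 1)))
    (hB1 : ∀ t < n, Rigid B (U t) (V t)) (hB2 : ∀ t < n, Owned B (V t) (U (t + 1))) :
    TilesMod (U n) A B := by
  induction n with
  | zero =>
    obtain ⟨a, ha⟩ := hA
    obtain ⟨b, hb⟩ := hB
    simp only [hU, TilesMod, AddSubgroup.mem_top]
    exact ⟨fun _ => ⟨a, ha, b, hb, trivial⟩, fun _ _ _ _ _ _ _ _ _ => ⟨trivial, trivial⟩⟩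
  | succ n ih =>
    obtain ⟨ih1, ih2⟩ := ih (fun t ht => hVU t (by omega)) (fun t ht => hUV t (by omega))
      (fun t ht => hA1 t (by omega)) (fun t ht => hA2 t (by omega))
      (fun t ht => hB1 t (by omega)) (fun t ht => hB2 t (by omega))
    have hn : n < n + 1 := n.lt_succ_self
    refine ⟨fun g => ?_, fun a ha a' ha' b hb b' hb' h => ?_⟩
    · obtain ⟨a, ha, b, hb, h⟩ := ih1 g
      obtain ⟨a₁, ha₁, h1⟩ := hA1 n hn a ha _ h
      obtain ⟨b₁, hb₁, h2⟩ := hB2 n hn b hb (g - (a₁ + b)) (by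
        convert (V n).neg_mem h1 using 1; abel)
      exact ⟨a₁, ha₁, b₁, hb₁, by convert (U (n + 1)).neg_mem h2 using 1; abel⟩
    · have h1 := ih2 a ha a' ha' b hb b' hb' (hVU n hn (hUV n hn h))
      have h2 := hB1 n hn b hb b' hb' h1.2
      have h3 : a - a' ∈ V n := by
        convert (V n).sub_mem (hUV n hn h) h2 using 1; abel
      have h4 := hA2 n hn a ha a' ha' h3
      refine ⟨h4, ?_⟩
      convert (U (n + 1)).sub_mem h h4 using 1; abel

/-- The elements `f 0, …, f (N - 1)` represent the classes of `U` modulo `V`. -/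
def IsTransversal (U V : AddSubgroup Γ) (N : ℕ) (f : ℕ → Γ) : Prop :=
  (∀ i < N, f i ∈ U) ∧ (∀ u ∈ U, ∃ i < N, u - f i ∈ V) ∧
    ∀ i < N, ∀ j < N, f i - f j ∈ V → i = j

/-- The sum of the digits `f t (i t)` and the corrections `ψ t i`. -/
def digitSum (f : ℕ → ℕ → Γ) (ψ : ℕ → (ℕ → ℕ) → Γ) (n : ℕ) (i : ℕ → ℕ) : Γ :=
  ∑ t ∈ range n, (f t (i t) + ψ t i)

/-- `ψ t i` depends on `i 0, …, i t` only. -/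
def IsAdapted {M : Type*} (ψ : ℕ → (ℕ → ℕ) → M) : Prop :=
  ∀ t i i', (∀ s ≤ t, i s = i' s) → ψ t i = ψ t i'

theorem digitSum_congr {f : ℕ → ℕ → Γ} {ψ : ℕ → (ℕ → ℕ) → Γ} (hψ : IsAdapted ψ) {n : ℕ}
    {i i' : ℕ → ℕ} (h : ∀ s < n, i s = i' s) : digitSum f ψ n i = digitSum f ψ n i' := by
  refine sum_congr rfl fun t ht => ?_
  rw [mem_range] at ht
  rw [h t ht, hψ t i i' fun s hs => h s (by omega)]

theorem antitone_of_interlaced {n : ℕ} {U V : ℕ → AddSubgroup Γ}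
    (hVU : ∀ t < n, V t ≤ U t) (hUV : ∀ t < n, U (t + 1) ≤ V t) {t : ℕ} :
    ∀ s, t ≤ s → s ≤ n → U s ≤ U t := by
  intro s hs
  induction s, hs using Nat.le_induction with
  | base => exact fun _ => le_rfl
  | succ s hs ih =>
    exact fun h => ((hUV s h).trans (hVU s h)).trans (ih (by omega))

section Param

variable {n : ℕ} {U V : ℕ → AddSubgroup Γ} {N : ℕ → ℕ} {f : ℕ → ℕ → Γ} {ψ : ℕ → (ℕ → ℕ) → Γ}

theorem digitSum_sub_mem (hVU : ∀ t < n, V t ≤ U t) (hUV : ∀ t < n, U (t + 1) ≤ V t)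
    (hf : ∀ t < n, IsTransversal (U t) (V t) (N t) (f t)) (hψ : ∀ t < n, ∀ i, ψ t i ∈ V t)
    {i : ℕ → ℕ} (hi : ∀ t < n, i t < N t) {t : ℕ} :
    ∀ s, t ≤ s → s ≤ n → digitSum f ψ s i - digitSum f ψ t i ∈ U t := by
  intro s hs
  induction s, hs using Nat.le_induction with
  | base => simp
  | succ s hs ih =>
    intro hsn
    have h1 : f s (i s) + ψ s i ∈ U s :=
      (U s).add_mem ((hf s hsn).1 _ (hi s hsn)) (hVU s hsn (hψ s hsn i))
    have h2 := antitone_of_interlaced hVU hUV s hs (by omega) h1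
    convert (U t).add_mem (ih (by omega)) h2 using 1
    simp only [digitSum, sum_range_succ]
    abel

theorem digitSum_sub_mem' (hVU : ∀ t < n, V t ≤ U t) (hUV : ∀ t < n, U (t + 1) ≤ V t)
    (hf : ∀ t < n, IsTransversal (U t) (V t) (N t) (f t)) (hψ : ∀ t < n, ∀ i, ψ t i ∈ V t)
    {i : ℕ → ℕ} (hi : ∀ t < n, i t < N t) {t : ℕ} (ht : t < n) :
    digitSum f ψ n i - digitSum f ψ t i - f t (i t) ∈ V t := by
  have h1 := hUV t ht (digitSum_sub_mem hVU hUV hf hψ hi n (t := t + 1) ht le_rfl)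
  convert (V t).add_mem h1 (hψ t ht i) using 1
  simp only [digitSum, sum_range_succ]
  abel

/-- Digits are read off in order: once those before `t` agree, so do their corrections, and only the
digit at `t` is visible modulo `V t`. -/
theorem eq_of_digitSum_sub_mem (hVU : ∀ t < n, V t ≤ U t) (hUV : ∀ t < n, U (t + 1) ≤ V t)
    (hf : ∀ t < n, IsTransversal (U t) (V t) (N t) (f t)) (hψ : ∀ t < n, ∀ i, ψ t i ∈ V t)
    (hdep : IsAdapted ψ) {i i' : ℕ → ℕ} (hi : ∀ t < n, i t < N t) (hi' : ∀ t < n, i' t < N t) :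
    ∀ t < n, digitSum f ψ n i - digitSum f ψ n i' ∈ V t → ∀ s ≤ t, i s = i' s := by
  intro t
  induction t using Nat.strong_induction_on with
  | _ t ih =>
    intro ht h
    have hlt : ∀ s < t, i s = i' s := by
      intro s hs
      refine ih s hs (by omega) (hUV s (by omega) ?_) s le_rfl
      exact antitone_of_interlaced hVU hUV t hs ht.le (hVU t ht h)
    intro s hs
    rcases hs.lt_or_eq with hs | rfl
    · exact hlt s hs
    · refine (hf s ht).2.2 _ (hi s ht) _ (hi' s ht) ?_
      have h1 := digitSum_sub_mem' hVU hUV hf hψ hi ht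
      have h2 := digitSum_sub_mem' hVU hUV hf hψ hi' ht
      rw [digitSum_congr hdep hlt] at h1
      convert (V s).sub_mem (((V s)).add_mem h h2) h1 using 1
      abel

/-- Owned: changing the digit at `t` alone realizes any shift by `U t` modulo `V t`. Rigid:
agreement modulo `V t` fixes the digits up to `t`, hence the corrections up to `t`. -/
theorem adapted_of_digits (hVU : ∀ t < n, V t ≤ U t) (hUV : ∀ t < n, U (t + 1) ≤ V t)
    (hf : ∀ t < n, IsTransversal (U t) (V t) (N t) (f t)) (hψ : ∀ t < n, ∀ i, ψ t i ∈ V t)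
    (hdep : IsAdapted ψ)
    (hA : ∀ g, g ∈ A ↔ ∃ i : ℕ → ℕ, (∀ t < n, i t < N t) ∧ g - digitSum f ψ n i ∈ U n) :
    (∀ a ∈ A, a ∈ U 0) ∧
      ∀ t < n, Owned A (U t) (V t) ∧ Rigid A (V t) (U (t + 1)) := by
  have hUn := fun t (ht : t ≤ n) => antitone_of_interlaced hVU hUV (t := t) n ht le_rfl
  refine ⟨fun a ha => ?_, fun t ht => ⟨fun a ha h hh => ?_, fun a ha a' ha' h => ?_⟩⟩
  · obtain ⟨i, hi, h⟩ := (hA a).1 ha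
    have h1 := digitSum_sub_mem hVU hUV hf hψ hi n (Nat.zero_le n) le_rfl
    convert (U 0).add_mem h1 (hUn 0 (Nat.zero_le n) h) using 1
    simp [digitSum]
  · obtain ⟨i, hi, h'⟩ := (hA a).1 ha
    obtain ⟨j, hj, h2⟩ := (hf t ht).2.1 (f t (i t) + h) ((U t).add_mem ((hf t ht).1 _ (hi t ht)) hh)
    have hi' : ∀ s < n, Function.update i t j s < N s := by
      intro s hs
      rcases eq_or_ne s t with rfl | hst
      · simpa using hj
      · simpa [hst] using hi s hs
    refine ⟨digitSum f ψ n (Function.update i t j), (hA _).2 ⟨_, hi', by simp⟩, ?_⟩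
    have h3 := digitSum_sub_mem' hVU hUV hf hψ hi ht
    have h4 := digitSum_sub_mem' hVU hUV hf hψ hi' ht
    have h5 : digitSum f ψ t (Function.update i t j) = digitSum f ψ t i :=
      digitSum_congr hdep fun s hs => by simp [hs.ne]
    rw [h5, Function.update_self] at h4
    have h6 := hUV t ht (hUn (t + 1) ht h')
    convert (V t).sub_mem ((V t).sub_mem ((V t).sub_mem h4 h3) h2) h6 using 1
    abel
  · obtain ⟨i, hi, h1⟩ := (hA a).1 ha
    obtain ⟨i', hi', h1'⟩ := (hA a').1 ha'
    have hU' := hUn (t + 1) ht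
    have h2 : digitSum f ψ n i - digitSum f ψ n i' ∈ V t := by
      convert (V t).add_mem ((V t).sub_mem h (hUV t ht (hU' h1))) (hUV t ht (hU' h1')) using 1
      abel
    have h3 := eq_of_digitSum_sub_mem hVU hUV hf hψ hdep hi hi' t ht h2
    have h4 := digitSum_sub_mem hVU hUV hf hψ hi n (t := t + 1) ht le_rfl
    have h5 := digitSum_sub_mem hVU hUV hf hψ hi' n (t := t + 1) ht le_rfl
    rw [digitSum_congr (n := t + 1) hdep fun s hs => h3 s (by omega)] at h4
    convert (U (t + 1)).sub_mem ((U (t + 1)).sub_mem ((U (t + 1)).add_mem h4 (hU' h1)) h5)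
      (hU' h1') using 1
    abel

open Classical in
/-- A correction in `W` that moves `x` into `A` modulo `U`, equal to `0` if this is possible. -/
noncomputable def correction (A : Set Γ) (U : AddSubgroup Γ) (W : Set Γ) (x : Γ) : Γ :=
  if ∃ a ∈ A, a - x ∈ U then 0
  else if h : ∃ w ∈ W, ∃ a ∈ A, a - (x + w) ∈ U then h.choose else 0

theorem correction_mem {U : AddSubgroup Γ} {W : Set Γ} (hW : (0 : Γ) ∈ W) (x : Γ) :
    correction A U W x ∈ W := by
  unfold correction
  split_ifs with h1 h2
  · exact hW
  · exact h2.choose_spec.1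
  · exact hW

theorem exists_sub_correction_mem {U : AddSubgroup Γ} {W : Set Γ} {x : Γ}
    (h : ∃ w ∈ W, ∃ a ∈ A, a - (x + w) ∈ U) : ∃ a ∈ A, a - (x + correction A U W x) ∈ U := by
  unfold correction
  split_ifs with h1
  · simpa using h1
  · exact h.choose_spec.2

/-- Partial sums of digits, corrected at every level so as to stay in `A`. -/
noncomputable def corrected (A : Set Γ) (U : ℕ → AddSubgroup Γ) (W : ℕ → Set Γ)
    (f : ℕ → ℕ → Γ) : ℕ → (ℕ → ℕ) → Γ
  | 0, _ => 0
  | t + 1, i => corrected A U W f t i + f t (i t) +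
      correction A (U (t + 1)) (W t) (corrected A U W f t i + f t (i t))

theorem corrected_congr {W : ℕ → Set Γ} {t : ℕ} {i i' : ℕ → ℕ} (h : ∀ s < t, i s = i' s) :
    corrected A U W f t i = corrected A U W f t i' := by
  induction t with
  | zero => rfl
  | succ t ih => simp only [corrected, ih fun s hs => h s (by omega), h t (by omega)]

/-- Greedy construction: append a free digit, then return to `A` modulo the next subgroup by a
correction from `W t`. Ownership makes every digit possible. The set `W t` lets the caller prescribe
the shape of the corrections. -/
theorem exists_digits (hUV : ∀ t < n, U (t + 1) ≤ V t)
    (hf : ∀ t < n, IsTransversal (U t) (V t) (N t) (f t)) (hf0 : ∀ t, f t 0 = 0)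
    (W : ℕ → Set Γ) (hW0 : ∀ t, (0 : Γ) ∈ W t)
    (hW : ∀ t < n, ∀ v ∈ V t, ∃ w ∈ W t, v - w ∈ U (t + 1)) (hWV : ∀ t < n, ∀ w ∈ W t, w ∈ V t)
    (h0 : (0 : Γ) ∈ A) (hAU : ∀ a ∈ A, ∀ u ∈ U n, a + u ∈ A) (hA0 : ∀ a ∈ A, a ∈ U 0)
    (hO : ∀ t < n, Owned A (U t) (V t)) (hR : ∀ t < n, Rigid A (V t) (U (t + 1))) :
    ∃ ψ : ℕ → (ℕ → ℕ) → Γ, IsAdapted ψ ∧ (∀ t i, ψ t i ∈ W t) ∧ (∀ t, ψ t (fun _ => 0) = 0) ∧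
      ∀ g, g ∈ A ↔ ∃ i : ℕ → ℕ, (∀ t < n, i t < N t) ∧ g - digitSum f ψ n i ∈ U n := by
  set X := corrected A U W f with hX
  let ψ : ℕ → (ℕ → ℕ) → Γ := fun t i => correction A (U (t + 1)) (W t) (X t i + f t (i t))
  have hsum : ∀ t i, digitSum f ψ t i = X t i := by
    intro t i
    induction t with
    | zero => rfl
    | succ t ih =>
      have : X (t + 1) i = X t i + f t (i t) + ψ t i := rfl
      rw [this, ← ih, digitSum, sum_range_succ, digitSum]
      abel
  have hmem : ∀ i : ℕ → ℕ, (∀ t < n, i t < N t) → ∀ t ≤ n, ∃ a ∈ A, a - X t i ∈ U t := by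
    intro i hi t
    induction t with
    | zero => exact fun _ => ⟨0, h0, by simp [hX, corrected]⟩
    | succ t ih =>
      intro ht
      obtain ⟨a, ha, h⟩ := ih (by omega)
      obtain ⟨a₁, ha₁, h1⟩ := hO t ht a ha (-(a - X t i) + f t (i t))
        ((U t).add_mem ((U t).neg_mem h) ((hf t ht).1 _ (hi t ht)))
      obtain ⟨w, hw, h2⟩ := hW t ht _ h1
      refine exists_sub_correction_mem ⟨w, hw, a₁, ha₁, ?_⟩
      convert h2 using 1
      abel
  refine ⟨ψ, fun t i i' h => ?_, fun t i => correction_mem (hW0 t) _, fun t => ?_, fun g => ?_⟩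
  · simp only [ψ, hX]
    rw [corrected_congr (i' := i') fun s hs => h s hs.le, h t le_rfl]
  · have hz : X t (fun _ => 0) = 0 := by
      induction t with
      | zero => rfl
      | succ t ih =>
        have : X (t + 1) (fun _ => 0) = X t (fun _ => 0) + f t 0 + ψ t (fun _ => 0) := rfl
        rw [this, ih, hf0]
        simp only [ψ, ih, hf0, correction]
        rw [if_pos ⟨0, h0, by simp [ih, hf0]⟩]
        simp
    simp only [ψ, hz, hf0, correction]
    rw [if_pos ⟨0, h0, by simp [hz, hf0]⟩]
  · simp only [hsum]
    constructor
    · intro hg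
      have : ∀ t ≤ n, ∃ i : ℕ → ℕ, (∀ s < t, i s < N s) ∧ g - X t i ∈ U t := by
        intro t
        induction t with
        | zero => exact fun _ => ⟨fun _ => 0, by simp, by simpa [hX, corrected] using hA0 g hg⟩
        | succ t ih =>
          intro ht
          obtain ⟨i, hi, h⟩ := ih (by omega)
          obtain ⟨j, hj, h1⟩ := (hf t ht).2.1 _ h
          -- extend the digits below `t` by `j`, then by any admissible digits above `t`
          have hN : ∀ s < n, ∃ x, x < N s := fun s hs =>
            let ⟨x, hx, _⟩ := (hf s hs).2.1 0 (U s).zero_mem; ⟨x, hx⟩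
          choose! e he using hN
          let i' : ℕ → ℕ := fun s => if s < t then i s else if s = t then j else e s
          have hi' : ∀ s < n, i' s < N s := by
            intro s hs
            simp only [i']
            split_ifs with h1 h2
            · exact hi s h1
            · exact h2 ▸ hj
            · exact he s hs
          refine ⟨i', fun s hs => hi' s (by omega), ?_⟩
          obtain ⟨a, ha, h2⟩ := hmem i' hi' (t + 1) ht
          have h3 : X t i' = X t i := corrected_congr fun s hs => by simp [i', hs]
          have h4 : X (t + 1) i' = X t i' + f t (i' t) + ψ t i' := rfl
          have h5 : i' t = j := by simp [i']
          rw [h3, h5] at h4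
          have h6 : g - X (t + 1) i' ∈ V t := by
            rw [h4]
            convert (V t).sub_mem h1 (hWV t ht _ (correction_mem (A := A) (U := U (t + 1))
              (hW0 t) (X t i' + f t (i' t)))) using 1
            simp only [ψ]
            abel
          have h7 : g - a ∈ V t := by
            convert (V t).sub_mem h6 (hUV t ht h2) using 1
            abel
          -- The correction was chosen without regard to `g`; rigidity shows that it fits `g` all
          -- the same.
          have h8 := hR t ht g hg a ha h7
          convert (U (t + 1)).add_mem h8 h2 using 1
          abel
      exact this n le_rfl
    · rintro ⟨i, hi, h⟩
      obtain ⟨a, ha, h1⟩ := hmem i hi n le_rfl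
      have := hAU a ha _ ((U n).sub_mem h h1)
      convert this using 1
      abel

end Param

end Tilings

/-! ### Vanishing character sums and periods of order two -/

section Characters

/-- Since `ζ ^ 2 ^ q = -1`, the sum folds to a rational polynomial in `ζ` of degree below `2 ^ q`
with coefficients `c j - c (j + 2 ^ q)`. The minimal polynomial of `ζ` has degree `2 ^ q`, so they
all vanish. -/
theorem periodic_of_sum_pow_eq_zero {q : ℕ} {ζ : ℂ} (hζ : IsPrimitiveRoot ζ (2 ^ (q + 1)))
    (c : ZMod (2 ^ (q + 1)) → ℚ) (h : ∑ x, (c x : ℂ) * ζ ^ x.val = 0)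
    (x : ZMod (2 ^ (q + 1))) : c (x + 2 ^ q) = c x := by
  have hpow : (2 : ℕ) ^ (q + 1) = 2 ^ q + 2 ^ q := by rw [pow_succ]; ring
  have hhalf : ζ ^ 2 ^ q = -1 := by
    have h1 : (ζ ^ 2 ^ q) ^ 2 = 1 := by rw [← pow_mul, ← pow_succ, hζ.pow_eq_one]
    have h2 : ζ ^ 2 ^ q ≠ 1 :=
      hζ.pow_ne_one_of_pos_of_lt (by positivity) (by rw [hpow]; have := Nat.two_pow_pos q; omega)
    exact (mul_self_eq_one_iff.1 (by rw [← sq, h1])).resolve_left h2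
  have hsum : ∑ x, (c x : ℂ) * ζ ^ x.val
      = ∑ j ∈ range (2 ^ (q + 1)), (c (j : ZMod (2 ^ (q + 1))) : ℂ) * ζ ^ j := by
    refine sum_nbij' (fun x => x.val) (fun j => (j : ZMod (2 ^ (q + 1)))) ?_ ?_ ?_ ?_ ?_
    · exact fun x _ => mem_range.2 x.val_lt
    · exact fun _ _ => mem_univ _
    · exact fun x _ => ZMod.natCast_zmod_val x
    · exact fun j hj => ZMod.val_cast_of_lt (mem_range.1 hj)
    · exact fun x _ => by rw [ZMod.natCast_zmod_val]
  let d : ℕ → ℚ := fun j => c j - c ((j : ZMod (2 ^ (q + 1))) + 2 ^ q)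
  let P : Polynomial ℚ := ∑ j ∈ range (2 ^ q), Polynomial.monomial j (d j)
  have hP : Polynomial.aeval ζ P = 0 := by
    rw [← h, hsum, show range (2 ^ (q + 1)) = range (2 ^ q + 2 ^ q) by rw [hpow],
      sum_range_add, ← sum_add_distrib, map_sum]
    refine sum_congr rfl fun j _ => ?_
    rw [Polynomial.aeval_monomial, pow_add ζ, hhalf]
    simp only [d, eq_ratCast]
    push_cast
    rw [add_comm (2 ^ q : ZMod (2 ^ (q + 1))) j]
    ring
  have hdeg : P.degree < (2 ^ q : ℕ) := by
    refine lt_of_le_of_lt (Polynomial.degree_sum_le _ _) ?_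
    refine (Finset.sup_lt_iff (WithBot.bot_lt_coe _)).2 fun j hj => ?_
    exact lt_of_le_of_lt (Polynomial.degree_monomial_le _ _)
      (by exact_mod_cast mem_range.1 hj)
  have hP0 : P = 0 := by
    by_contra hne
    have h1 := minpoly.degree_le_of_ne_zero ℚ ζ hne hP
    rw [← Polynomial.cyclotomic_eq_minpoly_rat hζ (by positivity), Polynomial.degree_cyclotomic,
      Nat.totient_prime_pow_succ Nat.prime_two] at h1
    simp only [Nat.reduceSub, mul_one] at h1
    exact absurd hdeg (not_lt.2 h1)
  have hd : ∀ j < 2 ^ q, d j = 0 := by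
    intro j hj
    have h1 : P.coeff j = d j := by
      simp only [P, Polynomial.finsetSum_coeff, Polynomial.coeff_monomial]
      rw [sum_ite_eq' (range (2 ^ q)) j d, if_pos (mem_range.2 hj)]
    rw [← h1, hP0, Polynomial.coeff_zero]
  have htwo : (2 ^ q + 2 ^ q : ZMod (2 ^ (q + 1))) = 0 := by
    have := (congrArg (Nat.cast (R := ZMod (2 ^ (q + 1)))) hpow).symm.trans
      (ZMod.natCast_self (2 ^ (q + 1)))
    exact_mod_cast this
  have hx := x.val_lt
  rcases lt_or_ge x.val (2 ^ q) with hlt | hge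
  · have := hd _ hlt
    simp only [d, ZMod.natCast_zmod_val] at this
    linarith
  · have h1 := hd (x.val - 2 ^ q) (by omega)
    have h2 : (((x.val - 2 ^ q : ℕ)) : ZMod (2 ^ (q + 1))) = x + 2 ^ q := by
      rw [Nat.cast_sub hge, ZMod.natCast_zmod_val, sub_eq_iff_eq_add, add_assoc]
      push_cast
      rw [htwo, add_zero]
    simp only [d, h2, add_assoc, htwo, add_zero] at h1
    linarith

/-- The values of `φ` on `A` are equidistributed under translation by `2 ^ q`. -/
def IsEquidistributed {Q : Type*} {q : ℕ} (φ : Q → ZMod (2 ^ (q + 1))) (A : Set Q) : Prop :=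
  ∀ x, {a ∈ A | φ a = x + 2 ^ q}.ncard = {a ∈ A | φ a = x}.ncard

theorem isPrimitiveRoot_stdAddChar_one (N : ℕ) [NeZero N] :
    IsPrimitiveRoot (ZMod.stdAddChar (1 : ZMod N)) N := by
  have key : ∀ l : ℕ, ZMod.stdAddChar (1 : ZMod N) ^ l = ZMod.stdAddChar (l : ZMod N) := by
    intro l
    rw [← AddChar.map_nsmul_eq_pow, nsmul_one]
  refine ⟨by rw [key, ZMod.natCast_self, AddChar.map_zero_eq_one], fun l hl => ?_⟩
  rw [key, ← AddChar.map_zero_eq_one (ZMod.stdAddChar (N := N))] at hl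
  exact (ZMod.natCast_eq_zero_iff _ _).1 (ZMod.injective_stdAddChar hl)

theorem isEquidistributed_of_sum_eq_zero {Q : Type*} {q : ℕ} (φ : Q → ZMod (2 ^ (q + 1)))
    (A : Finset Q)
    (h : ∑ a ∈ A, ZMod.stdAddChar (φ a) = 0) : IsEquidistributed φ (A : Set Q) := by
  classical
  intro x
  have hcard : ∀ x, {a ∈ (A : Set Q) | φ a = x}.ncard = (A.filter fun a => φ a = x).card := by
    intro x
    rw [← Set.ncard_coe_finset]
    congr 1
    ext a
    simp
  rw [hcard, hcard]
  have := periodic_of_sum_pow_eq_zero (isPrimitiveRoot_stdAddChar_one (2 ^ (q + 1)))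
    (fun x => ((A.filter fun a => φ a = x).card : ℚ)) (by
      rw [← h, ← sum_fiberwise A φ]
      refine sum_congr rfl fun x _ => ?_
      rw [sum_congr rfl (g := fun _ => ZMod.stdAddChar x) fun a ha => by
        rw [(mem_filter.1 ha).2], sum_const, nsmul_eq_mul, ← AddChar.map_nsmul_eq_pow, nsmul_one,
        ZMod.natCast_zmod_val]
      simp) x
  exact_mod_cast this

variable {Q : Type*} [AddCommGroup Q] [Finite Q] {q : ℕ} {A B : Set Q}

/-- A faithful character of the target, composed with `φ`, is nontrivial on `Q`; by the tiling its
zero sum over `Q` factors over `A` and `B`. -/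
theorem TilesMod.isEquidistributed_or (hT : TilesMod ⊥ A B) (φ : Q →+ ZMod (2 ^ (q + 1)))
    (hφ : φ ≠ 0) : IsEquidistributed φ A ∨ IsEquidistributed φ B := by
  classical
  have := Fintype.ofFinite Q
  let χ : AddChar Q ℂ := ZMod.stdAddChar.compAddMonoidHom φ
  have hχ : χ ≠ 0 := by
    intro h0
    apply hφ
    ext g
    have h1 : χ g = 1 := by rw [h0]; rfl
    refine ZMod.injective_stdAddChar ?_
    simpa [χ] using h1
  have hprod : (∑ a ∈ A.toFinset, χ a) * ∑ b ∈ B.toFinset, χ b = 0 := by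
    rw [sum_mul_sum, ← sum_product', ← AddChar.sum_eq_zero_iff_ne_zero.2 hχ]
    refine sum_bij (fun p _ => p.1 + p.2) (fun _ _ => mem_univ _) ?_ ?_ ?_
    · rintro ⟨a, b⟩ hab ⟨a', b'⟩ hab' h
      simp only [mem_product, Set.mem_toFinset] at hab hab'
      have := hT.2 a hab.1 a' hab'.1 b hab.2 b' hab'.2 (by simpa [sub_eq_zero] using h)
      simp only [AddSubgroup.mem_bot, sub_eq_zero] at this
      rw [this.1, this.2]
    · intro g _
      obtain ⟨a, ha, b, hb, h⟩ := hT.1 g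
      refine ⟨(a, b), by simp [ha, hb], ?_⟩
      rw [AddSubgroup.mem_bot, sub_eq_zero] at h
      exact h.symm
    · rintro ⟨a, b⟩ _
      exact (AddChar.map_add_eq_mul χ a b).symm
  rcases mul_eq_zero.1 hprod with h | h
  · left
    simpa using isEquidistributed_of_sum_eq_zero φ A.toFinset h
  · right
    simpa using isEquidistributed_of_sum_eq_zero φ B.toFinset h

/-- The fibre over `φ a + 2 ^ q` is as large as the one containing `a`, hence nonempty, and its
points differ from `a + h` by elements of the kernel. -/
theorem IsEquidistributed.exists_mem {φ : Q →+ ZMod (2 ^ (q + 1))} (hA : IsEquidistributed φ A)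
    {h κ : Q} (hφ : φ h = 2 ^ q) (hker : ∀ g, φ g = 0 → g = 0 ∨ g = κ) {a : Q} (ha : a ∈ A) :
    a + h ∈ A ∨ a + h + κ ∈ A := by
  have h1 : {b ∈ A | φ b = φ a}.ncard ≠ 0 := by
    rw [Ne, Set.ncard_eq_zero]
    exact Set.Nonempty.ne_empty ⟨a, ha, rfl⟩
  rw [← hA] at h1
  obtain ⟨a', ha', h2⟩ := Set.nonempty_of_ncard_ne_zero h1
  rcases hker (a' - (a + h)) (by rw [map_sub, map_add, h2, hφ, sub_self]) with h3 | h3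
  · left
    rwa [← sub_eq_zero.1 h3]
  · right
    rwa [← h3, add_sub_cancel]

/-- If `a + h ∉ A`, then `φ₁` forces `a + u ∈ A`. The `φ₀`-fibre of `a` then has two points in `A`,
while the shifted fibre `{a + h, a + h + u}` has at most one. -/
theorem add_mem_of_isEquidistributed {φ₀ φ₁ : Q →+ ZMod (2 ^ (q + 1))} {h u : Q}
    (hh : h + h = 0) (hu : u ≠ 0) (h₀ : φ₀ h = 2 ^ q) (h₁ : φ₁ h = 2 ^ q) (hφu : φ₀ u = 0)
    (hker₀ : ∀ g, φ₀ g = 0 → g = 0 ∨ g = u) (hker₁ : ∀ g, φ₁ g = 0 → g = 0 ∨ g = h + u)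
    (hA₀ : IsEquidistributed φ₀ A) (hA₁ : IsEquidistributed φ₁ A) {a : Q} (ha : a ∈ A) :
    a + h ∈ A := by
  by_contra hne
  have h2 : a + u ∈ A := by
    refine ((hA₁.exists_mem h₁ hker₁ ha).resolve_left hne : _) |> fun h3 => ?_
    convert h3 using 1
    rw [add_assoc, ← add_assoc h, hh, zero_add]
  have h3 : ({a, a + u} : Set Q) ⊆ {b ∈ A | φ₀ b = φ₀ a} := by
    rintro b (rfl | rfl)
    · exact ⟨ha, rfl⟩
    · exact ⟨h2, by rw [map_add, hφu, add_zero]⟩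
  have h4 : {b ∈ A | φ₀ b = φ₀ a + 2 ^ q} ⊆ {a + h + u} := by
    rintro b ⟨hb, hb'⟩
    rcases hker₀ (b - (a + h)) (by rw [map_sub, map_add, hb', h₀, sub_self]) with h5 | h5
    · exact absurd (sub_eq_zero.1 h5 ▸ hb) hne
    · rw [Set.mem_singleton_iff, ← h5, add_sub_cancel]
  have h5 := Set.ncard_le_ncard h3
  have h6 := Set.ncard_le_ncard h4
  rw [Set.ncard_pair (by simpa using hu)] at h5
  rw [Set.ncard_singleton, hA₀] at h6
  omega

/-- If both periods failed, at `a` and at `b`, then `a + h ∈ A` and `b + h ∈ B`, and `(a + h) + b =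
a + (b + h)` would contradict uniqueness. -/
theorem TilesMod.periodic_of_isEquidistributed (hT : TilesMod ⊥ A B)
    {φ₀ φ₁ : Q →+ ZMod (2 ^ (q + 1))} {h u : Q} (hh : h + h = 0) (hh0 : h ≠ 0)
    (h₀ : φ₀ h = 2 ^ q) (h₁ : φ₁ h = 2 ^ q)
    (hker₀ : ∀ g, φ₀ g = 0 → g = 0 ∨ g = u) (hker₁ : ∀ g, φ₁ g = 0 → g = 0 ∨ g = h + u)
    (hA : IsEquidistributed φ₀ A) (hB : IsEquidistributed φ₁ B) :
    (∀ a ∈ A, a + (h + u) ∈ A) ∨ ∀ b ∈ B, b + u ∈ B := by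
  by_contra! hne
  obtain ⟨⟨a, ha, ha'⟩, b, hb, hb'⟩ := hne
  have h1 : a + h ∈ A := by
    refine (hA.exists_mem h₀ hker₀ ha).resolve_right ?_
    rwa [add_assoc]
  have h2 : b + h ∈ B := by
    refine (hB.exists_mem h₁ hker₁ hb).resolve_right ?_
    rwa [add_assoc, ← add_assoc h, hh, zero_add]
  have := (hT.2 (a + h) h1 a ha b hb (b + h) h2 (by
    rw [AddSubgroup.mem_bot]; abel)).1
  rw [AddSubgroup.mem_bot, add_sub_cancel_left] at this
  exact hh0 this

/-- The model is `ℤ_{2^(q+1)} × ℤ_2` with `h = (2^q, 0)`, `u = (0, 1)`, `φ₀ (x, y) = x` and `φ₁ (x,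
y) = x + 2^q y`. The cases are whether the two characters vanish on the same factor or on different
ones. -/
theorem TilesMod.exists_period (hT : TilesMod ⊥ A B)
    {φ₀ φ₁ : Q →+ ZMod (2 ^ (q + 1))} {h u : Q} (hh : h + h = 0) (hh0 : h ≠ 0) (hu : u ≠ 0)
    (h₀ : φ₀ h = 2 ^ q) (h₁ : φ₁ h = 2 ^ q) (hφu : φ₀ u = 0)
    (hker₀ : ∀ g, φ₀ g = 0 → g = 0 ∨ g = u) (hker₁ : ∀ g, φ₁ g = 0 → g = 0 ∨ g = h + u) :
    ((∀ a ∈ A, a + h ∈ A) ∨ ∀ b ∈ B, b + h ∈ B) ∨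
      ((∀ a ∈ A, a + u ∈ A) ∨ ∀ b ∈ B, b + u ∈ B) ∨
        ((∀ a ∈ A, a + (h + u) ∈ A) ∨ ∀ b ∈ B, b + (h + u) ∈ B) := by
  have hne : (2 ^ q : ZMod (2 ^ (q + 1))) ≠ 0 := by
    have : ((2 ^ q : ℕ) : ZMod (2 ^ (q + 1))) ≠ 0 := by
      rw [Ne, ZMod.natCast_eq_zero_iff, Nat.pow_dvd_pow_iff_le_right (by norm_num)]
      omega
    exact_mod_cast this
  have hφ₀ : φ₀ ≠ 0 := by rintro rfl; exact hne h₀.symm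
  have hφ₁ : φ₁ ≠ 0 := by rintro rfl; exact hne h₁.symm
  rcases hT.isEquidistributed_or φ₀ hφ₀ with hA₀ | hB₀ <;>
    rcases hT.isEquidistributed_or φ₁ hφ₁ with hA₁ | hB₁
  · exact Or.inl (Or.inl fun a =>
      add_mem_of_isEquidistributed hh hu h₀ h₁ hφu hker₀ hker₁ hA₀ hA₁)
  · rcases hT.periodic_of_isEquidistributed hh hh0 h₀ h₁ hker₀ hker₁ hA₀ hB₁ with h | h <;> tauto
  · rcases hT.symm.periodic_of_isEquidistributed hh hh0 h₀ h₁ hker₀ hker₁ hB₀ hA₁ with h | h <;>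
      tauto
  · exact Or.inl (Or.inr fun b =>
      add_mem_of_isEquidistributed hh hu h₀ h₁ hφu hker₀ hker₁ hB₀ hB₁)

theorem TilesMod.image {Γ R : Type*} [AddCommGroup Γ] [AddCommGroup R] {A B : Set Γ} (π : Γ →+ R)
    (hπ : Function.Surjective π) (hT : TilesMod π.ker A B) : TilesMod ⊥ (π '' A) (π '' B) := by
  refine ⟨fun g => ?_, ?_⟩
  · obtain ⟨g, rfl⟩ := hπ g
    obtain ⟨a, ha, b, hb, h⟩ := hT.1 g
    exact ⟨_, ⟨a, ha, rfl⟩, _, ⟨b, hb, rfl⟩, by simpa [AddMonoidHom.mem_ker] using h⟩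
  · rintro _ ⟨a, ha, rfl⟩ _ ⟨a', ha', rfl⟩ _ ⟨b, hb, rfl⟩ _ ⟨b', hb', rfl⟩ h
    have := hT.2 a ha a' ha' b hb b' hb' (by simpa [AddMonoidHom.mem_ker] using h)
    simpa [AddMonoidHom.mem_ker] using this

end Characters

/-! ### The lattices and the chain of steps of a tiling -/

section Lattices

/-- The pairs `(x, y)` with `2 ^ p ∣ x` and `2 ∣ y`. -/
def latL (p : ℕ) : AddSubgroup (ℤ × ℤ) where
  carrier := {g | (2 : ℤ) ^ p ∣ g.1 ∧ (2 : ℤ) ∣ g.2}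
  add_mem' h h' := ⟨dvd_add h.1 h'.1, dvd_add h.2 h'.2⟩
  zero_mem' := ⟨dvd_zero _, dvd_zero _⟩
  neg_mem' h := ⟨(dvd_neg (b := _)).2 h.1, (dvd_neg (b := _)).2 h.2⟩

/-- The pairs `(x, y)` with `2 ^ p ∣ x - c * y`. -/
def latB (c : ℤ) (p : ℕ) : AddSubgroup (ℤ × ℤ) where
  carrier := {g | (2 : ℤ) ^ p ∣ g.1 - c * g.2}
  add_mem' {a b} h h' := by
    have h1 : (2 : ℤ) ^ p ∣ (a.1 - c * a.2) + (b.1 - c * b.2) := dvd_add h h'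
    change (2 : ℤ) ^ p ∣ (a.1 + b.1) - c * (a.2 + b.2)
    rwa [show a.1 + b.1 - c * (a.2 + b.2) = a.1 - c * a.2 + (b.1 - c * b.2) by ring]
  zero_mem' := by simp
  neg_mem' {a} h := by
    have h1 : (2 : ℤ) ^ p ∣ -(a.1 - c * a.2) := (dvd_neg (b := _)).2 h
    change (2 : ℤ) ^ p ∣ -a.1 - c * -a.2
    rwa [show -a.1 - c * -a.2 = -(a.1 - c * a.2) by ring]

theorem mem_latL {p : ℕ} {g : ℤ × ℤ} : g ∈ latL p ↔ (2 : ℤ) ^ p ∣ g.1 ∧ (2 : ℤ) ∣ g.2 := Iff.rfl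

theorem mem_latB {c : ℤ} {p : ℕ} {g : ℤ × ℤ} :
    g ∈ latB c p ↔ (2 : ℤ) ^ p ∣ g.1 - c * g.2 := Iff.rfl

theorem latL_anti {p q : ℕ} (h : p ≤ q) : latL q ≤ latL p :=
  fun _ hg => ⟨(pow_dvd_pow 2 h).trans hg.1, hg.2⟩

theorem latB_anti {c : ℤ} {p q : ℕ} (h : p ≤ q) : latB c q ≤ latB c p :=
  fun _ hg => (pow_dvd_pow 2 h).trans hg

theorem latL_le_latB {c : ℤ} {p q : ℕ} (hc : (2 : ℤ) ^ p ∣ 2 * c) (h : p ≤ q) :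
    latL q ≤ latB c p := by
  rintro ⟨x, y⟩ ⟨hx, z, hz⟩
  refine mem_latB.2 (dvd_sub ((pow_dvd_pow 2 h).trans hx) ?_)
  obtain ⟨w, hw⟩ := hc
  exact ⟨w * z, by simp only at hz ⊢; rw [hz]; linear_combination z * hw⟩

theorem latB_zero (c : ℤ) : latB c 0 = ⊤ := by
  ext g
  simp [mem_latB]

theorem two_pow_dvd_or {p : ℕ} {x : ℤ} (h : (2 : ℤ) ^ p ∣ x) :
    (2 : ℤ) ^ (p + 1) ∣ x ∨ (2 : ℤ) ^ (p + 1) ∣ x - 2 ^ p := by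
  obtain ⟨z, rfl⟩ := h
  rcases Int.even_or_odd' z with ⟨w, rfl | rfl⟩
  · exact Or.inl ⟨w, by ring⟩
  · exact Or.inr ⟨w, by ring⟩

theorem TilesMod.step_of_image {Γ R : Type*} [AddCommGroup Γ] [AddCommGroup R] {A B : Set Γ}
    {H H' : AddSubgroup Γ} (hT : TilesMod H' A B) (π : Γ →+ R) (hπ : π.ker = H') (hle : H' ≤ H)
    {κ : Γ} (hκ : κ ∈ H) (h2 : ∀ h ∈ H, h ∈ H' ∨ h - κ ∈ H')
    (h : (∀ a ∈ π '' A, a + π κ ∈ π '' A) ∨ ∀ b ∈ π '' B, b + π κ ∈ π '' B) :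
    Step A B H H' ∧ TilesMod H A B := by
  have lift : ∀ X : Set Γ, (∀ a ∈ π '' X, a + π κ ∈ π '' X) → ∀ a ∈ X, ∃ a' ∈ X,
      a' - a - κ ∈ H' := by
    intro X hX a ha
    obtain ⟨a', ha', h⟩ := hX _ ⟨a, ha, rfl⟩
    exact ⟨a', ha', by rw [← hπ, AddMonoidHom.mem_ker, map_sub, map_sub, h]; abel⟩
  rcases h with h | h
  · obtain ⟨h3, h4, h5⟩ := hT.of_period hle κ h2 hκ (lift A h)
    exact ⟨Or.inl ⟨h3, h4⟩, h5⟩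
  · obtain ⟨h3, h4, h5⟩ := hT.symm.of_period hle κ h2 hκ (lift B h)
    exact ⟨Or.inr ⟨h3, h4⟩, h5.symm⟩

variable {A B : Set (ℤ × ℤ)}

theorem TilesMod.periodic_zmod {q : ℕ} {A B : Set (ZMod (2 ^ (q + 1)))} (hT : TilesMod ⊥ A B) :
    (∀ a ∈ A, a + 2 ^ q ∈ A) ∨ ∀ b ∈ B, b + 2 ^ q ∈ B := by
  have key : ∀ X : Set (ZMod (2 ^ (q + 1))),
      IsEquidistributed (AddMonoidHom.id (ZMod (2 ^ (q + 1)))) X → ∀ a ∈ X, a + 2 ^ q ∈ X := by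
    intro X hX a ha
    have := hX.exists_mem (h := 2 ^ q) (κ := 0) rfl (fun g hg => Or.inl hg) ha
    simpa using this
  have : Fact (1 < 2 ^ (q + 1)) := ⟨Nat.one_lt_two_pow (by omega)⟩
  rcases hT.isEquidistributed_or (AddMonoidHom.id _) (fun h => by
    simpa using DFunLike.congr_fun h 1) with h | h
  · exact Or.inl (key A h)
  · exact Or.inr (key B h)

/-- The quotient by `latB c (p + 1)` is cyclic of order `2 ^ (p + 1)`, through `(x, y) ↦ x - c * y`.
-/
theorem TilesMod.step_latB {c : ℤ} {p : ℕ} (hT : TilesMod (latB c (p + 1)) A B) :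
    Step A B (latB c p) (latB c (p + 1)) ∧ TilesMod (latB c p) A B := by
  let π : ℤ × ℤ →+ ZMod (2 ^ (p + 1)) :=
    { toFun := fun g => ((g.1 - c * g.2 : ℤ) : ZMod (2 ^ (p + 1)))
      map_zero' := by simp
      map_add' := fun a b => by push_cast [Prod.fst_add, Prod.snd_add]; ring }
  have hker : π.ker = latB c (p + 1) := by
    ext g
    rw [AddMonoidHom.mem_ker, mem_latB]
    have := ZMod.intCast_zmod_eq_zero_iff_dvd (g.1 - c * g.2) (2 ^ (p + 1))
    push_cast at this
    rw [← this]
    simp [π]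
  have hπ : Function.Surjective π := fun x => by
    obtain ⟨z, rfl⟩ := ZMod.intCast_surjective x
    exact ⟨(z, 0), by simp [π]⟩
  have hT' := (TilesMod.image π hπ (by rwa [hker])).periodic_zmod
  refine (hT.step_of_image π hker (latB_anti p.le_succ) (κ := (2 ^ p, 0)) ?_ ?_ ?_)
  · simp [mem_latB]
  · intro h hh
    rcases two_pow_dvd_or (mem_latB.1 hh) with h1 | h1
    · exact Or.inl h1
    · refine Or.inr (mem_latB.2 ?_)
      convert h1 using 1
      simp
      ring
  · have : π (2 ^ p, 0) = 2 ^ p := by simp [π]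
    rwa [this]

theorem TilesMod.steps_latB {c : ℤ} {d : ℕ} (hT : TilesMod (latB c d) A B) :
    ∀ p < d, Step A B (latB c p) (latB c (p + 1)) := by
  induction d with
  | zero => simp
  | succ d ih =>
    intro p hp
    rcases Nat.lt_succ_iff_lt_or_eq.1 hp with h | rfl
    · exact ih hT.step_latB.2 p h
    · exact hT.step_latB.1

theorem TilesMod.step_latL_zero (hT : TilesMod (latL 0) A B) :
    Step A B (latB 0 0) (latL 0) := by
  let π : ℤ × ℤ →+ ZMod (2 ^ (0 + 1)) :=
    { toFun := fun g => ((g.2 : ℤ) : ZMod (2 ^ (0 + 1)))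
      map_zero' := by simp
      map_add' := fun a b => by push_cast [Prod.snd_add]; ring }
  have hker : π.ker = latL 0 := by
    ext g
    rw [AddMonoidHom.mem_ker, mem_latL]
    have := ZMod.intCast_zmod_eq_zero_iff_dvd g.2 (2 ^ (0 + 1))
    simpa [π] using this
  have hπ : Function.Surjective π := fun x => by
    obtain ⟨z, rfl⟩ := ZMod.intCast_surjective x
    exact ⟨(0, z), by simp [π]⟩
  have hT' := (TilesMod.image π hπ (by rwa [hker])).periodic_zmod
  refine (hT.step_of_image π hker (by rw [latB_zero]; exact le_top) (κ := (0, 1)) ?_ ?_ ?_).1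
  · simp [latB_zero]
  · rintro ⟨x, y⟩ -
    simp only [mem_latL, Prod.mk_sub_mk, pow_zero, isUnit_one, IsUnit.dvd, true_and]
    omega
  · have : π (0, 1) = 2 ^ 0 := by simp [π]
    rwa [this]

theorem mem_latL_succ_or {q : ℕ} {g : ℤ × ℤ} (hg : g ∈ latL q) :
    g ∈ latL (q + 1) ∨ g - (2 ^ q, 0) ∈ latL (q + 1) := by
  rcases two_pow_dvd_or (mem_latL.1 hg).1 with h1 | h1
  · exact Or.inl ⟨h1, hg.2⟩
  · exact Or.inr ⟨h1, by simpa using hg.2⟩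

theorem TilesMod.step_of_owned {q : ℕ} (hT : TilesMod (latL (q + 1)) A B)
    (h : Owned A (latL q) (latL (q + 1))) :
    Step A B (latL q) (latL (q + 1)) ∧ TilesMod (latL q) A B := by
  have hκ : ((2 ^ q, 0) : ℤ × ℤ) ∈ latL q := by simp [mem_latL]
  obtain ⟨h1, h2, h3⟩ := hT.of_period (latL_anti q.le_succ) (2 ^ q, 0)
    (fun _ => mem_latL_succ_or) hκ fun a ha => h a ha _ hκ
  exact ⟨Or.inl ⟨h1, h2⟩, h3⟩

/-- The quotient has three involutions. The period `(2^q, 0)` leads to `latL q`; the periods `(0,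
1)` and `(2^q, 1)` lead to cyclic quotients, those by `latB 0 (q + 1)` and `latB (2^q) (q + 1)`. -/
theorem TilesMod.step_latL {q : ℕ} (hT : TilesMod (latL (q + 1)) A B) :
    (Step A B (latL q) (latL (q + 1)) ∧ TilesMod (latL q) A B) ∨
    ∃ c : ℤ, (c = 0 ∨ c = 2 ^ q) ∧ Step A B (latB c (q + 1)) (latL (q + 1)) ∧
      TilesMod (latB c (q + 1)) A B := by
  let π : ℤ × ℤ →+ ZMod (2 ^ (q + 1)) × ZMod 2 :=
    { toFun := fun g => ((g.1 : ZMod (2 ^ (q + 1))), (g.2 : ZMod 2))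
      map_zero' := by simp
      map_add' := fun a b => by simp }
  have hker : π.ker = latL (q + 1) := by
    ext g
    rw [AddMonoidHom.mem_ker, mem_latL]
    have h1 := ZMod.intCast_zmod_eq_zero_iff_dvd g.1 (2 ^ (q + 1))
    have h2 := ZMod.intCast_zmod_eq_zero_iff_dvd g.2 2
    push_cast at h1 h2
    rw [← h1, ← h2]
    simp [π, Prod.ext_iff]
  have hπ : Function.Surjective π := fun ⟨x, y⟩ => by
    obtain ⟨z, rfl⟩ := ZMod.intCast_surjective x
    obtain ⟨w, rfl⟩ := ZMod.intCast_surjective y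
    exact ⟨(z, w), rfl⟩
  have htwo : (2 ^ q + 2 ^ q : ZMod (2 ^ (q + 1))) = 0 := by
    have h1 := ZMod.natCast_self (2 ^ (q + 1))
    push_cast at h1
    rw [← h1]
    ring
  have hhalf : (2 ^ q : ZMod (2 ^ (q + 1))) ≠ 0 := by
    have : ((2 ^ q : ℕ) : ZMod (2 ^ (q + 1))) ≠ 0 := by
      rw [Ne, ZMod.natCast_eq_zero_iff, Nat.pow_dvd_pow_iff_le_right (by norm_num)]
      omega
    exact_mod_cast this
  -- The map `y ↦ 2^q y`, so that `φ₁` below kills the involution `(2^q, 1)`.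
  let δ : ZMod 2 →+ ZMod (2 ^ (q + 1)) := ZMod.lift 2 ⟨zmultiplesHom _ (2 ^ q), by
    simpa [two_mul, two_zsmul] using htwo⟩
  have hδ : δ 1 = 2 ^ q := by
    have : δ ((1 : ℤ) : ZMod 2) = 2 ^ q := by
      simp only [δ, ZMod.lift_coe]
      simp
    simpa using this
  let φ₀ : ZMod (2 ^ (q + 1)) × ZMod 2 →+ ZMod (2 ^ (q + 1)) := AddMonoidHom.fst _ _
  let φ₁ : ZMod (2 ^ (q + 1)) × ZMod 2 →+ ZMod (2 ^ (q + 1)) :=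
    AddMonoidHom.fst _ _ + δ.comp (AddMonoidHom.snd _ _)
  have h01 : ∀ y : ZMod 2, y = 0 ∨ y = 1 := by decide
  have hper := (TilesMod.image π hπ (by rwa [hker])).exists_period (φ₀ := φ₀) (φ₁ := φ₁)
    (h := (2 ^ q, 0)) (u := (0, 1)) (by simp [htwo]) (by simp [Prod.ext_iff, hhalf]) (by simp)
    (by simp [φ₀]) (by simp [φ₁]) (by simp [φ₀])
    (by
      rintro ⟨x, y⟩ h
      have hx : x = 0 := h
      rcases h01 y with rfl | rfl <;> simp [hx])
    (by
      rintro ⟨x, y⟩ h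
      have hx : x + δ y = 0 := h
      rcases h01 y with rfl | rfl
      · left
        simpa using hx
      · right
        rw [hδ] at hx
        rw [← add_right_cancel (htwo.trans hx.symm)]
        simp)
  rcases hper with h | h | h
  · left
    refine hT.step_of_image π hker (latL_anti q.le_succ) (κ := (2 ^ q, 0)) ?_
      (fun _ => mem_latL_succ_or) ?_
    · simp [mem_latL]
    · have : π (2 ^ q, 0) = (2 ^ q, 0) := by simp [π]
      rwa [this]
  · right
    refine ⟨0, Or.inl rfl,
      (hT.step_of_image π hker (latL_le_latB (by simp) le_rfl) (κ := (0, 1)) ?_ ?_ ?_)⟩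
    · simp [mem_latB]
    · rintro ⟨x, y⟩ hh
      have hx : (2 : ℤ) ^ (q + 1) ∣ x := by simpa [mem_latB] using hh
      simp only [mem_latL, Prod.mk_sub_mk, sub_zero, hx, true_and]
      omega
    · have : π (0, 1) = (0, 1) := by simp [π]
      rwa [this]
  · right
    refine ⟨2 ^ q, Or.inr rfl,
      (hT.step_of_image π hker (latL_le_latB (by rw [pow_succ']) le_rfl)
        (κ := (2 ^ q, 1)) ?_ ?_ ?_)⟩
    · simp [mem_latB]
    · rintro ⟨x, y⟩ hh
      obtain ⟨z, hz⟩ := mem_latB.1 hh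
      simp only at hz
      simp only [mem_latL, Prod.mk_sub_mk]
      rcases Int.even_or_odd' y with ⟨w, rfl | rfl⟩
      · exact Or.inl ⟨⟨z + w, by linear_combination hz⟩, ⟨w, rfl⟩⟩
      · exact Or.inr ⟨⟨z + w, by linear_combination hz⟩, ⟨w, by ring⟩⟩
    · have : π (2 ^ q, 1) = (2 ^ q, 0) + (0, 1) := by simp [π]
      rwa [this]

/-- The construction climbs from `latL k` and stays among the `latL` as long as possible. This
preference yields the two non-ownership clauses, which family (b) needs later. -/
theorem TilesMod.exists_steps {k : ℕ} (hT : TilesMod (latL k) A B) :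
    ∃ d ≤ k, ∃ c : ℤ, (c = 0 ∨ 1 ≤ d ∧ c = 2 ^ (d - 1) ∧
        ¬ Owned A (latL (d - 1)) (latL d) ∧ ¬ Owned B (latL (d - 1)) (latL d)) ∧
      (∀ p < d, Step A B (latB c p) (latB c (p + 1))) ∧ Step A B (latB c d) (latL d) ∧
      ∀ p, d ≤ p → p < k → Step A B (latL p) (latL (p + 1)) := by
  induction k with
  | zero => exact ⟨0, le_rfl, 0, Or.inl rfl, by simp, hT.step_latL_zero, by omega⟩
  | succ k ih =>
    by_cases hO : Step A B (latL k) (latL (k + 1)) ∧ TilesMod (latL k) A B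
    · obtain ⟨hstep, hT'⟩ := hO
      obtain ⟨d, hd, c, hc, h1, h2, h3⟩ := ih hT'
      refine ⟨d, by omega, c, hc, h1, h2, fun p hp hpk => ?_⟩
      rcases Nat.lt_succ_iff_lt_or_eq.1 hpk with h | rfl
      · exact h3 p hp h
      · exact hstep
    · rcases hT.step_latL with h | ⟨c, hc, h1, h2⟩
      · exact absurd h hO
      · refine ⟨k + 1, le_rfl, c, ?_, h2.steps_latB, h1, by omega⟩
        refine hc.imp_right fun hc => ⟨by omega, hc, fun h => hO ?_, fun h => hO ?_⟩
        · exact hT.step_of_owned h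
        · exact (hT.symm.step_of_owned h).imp Step.symm TilesMod.symm

end Lattices

/-! ### Digits for the lattice steps -/

section Frames

theorem exists_lt_two_pow (z : ℤ) (w : ℕ) : ∃ i < 2 ^ w, (2 : ℤ) ^ w ∣ z - (i : ℕ) := by
  have hpos : (0 : ℤ) < 2 ^ w := by positivity
  have h0 := Int.emod_nonneg z hpos.ne'
  refine ⟨(z % 2 ^ w).toNat, ?_, ?_⟩
  · have := Int.emod_lt_of_pos z hpos
    zify
    rwa [Int.toNat_of_nonneg h0]
  · rw [Int.toNat_of_nonneg h0]
    exact Int.dvd_self_sub_emod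

theorem eq_of_two_pow_dvd_sub {w i j : ℕ} (hi : i < 2 ^ w) (hj : j < 2 ^ w)
    (h : (2 : ℤ) ^ w ∣ (i : ℤ) - j) : i = j := by
  have h1 : (j : ℤ) ≡ i [ZMOD ((2 ^ w : ℕ) : ℤ)] := Int.modEq_iff_dvd.2 (by exact_mod_cast h)
  exact ((Int.natCast_modEq_iff.1 h1).eq_of_lt_of_lt hj hi).symm

theorem two_pow_mul_dvd_iff {p q : ℕ} (h : p ≤ q) (z : ℤ) :
    (2 : ℤ) ^ q ∣ z * 2 ^ p ↔ (2 : ℤ) ^ (q - p) ∣ z := by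
  obtain ⟨w, rfl⟩ := Nat.exists_eq_add_of_le h
  rw [Nat.add_sub_cancel_left, add_comm, pow_add]
  exact mul_dvd_mul_iff_right (by positivity)

theorem isTransversal_latB (c : ℤ) {p q : ℕ} (h : p ≤ q) :
    IsTransversal (latB c p) (latB c q) (2 ^ (q - p)) fun i => ((i : ℤ) * 2 ^ p, 0) := by
  refine ⟨fun i _ => by simp [mem_latB], fun u hu => ?_, fun i hi j hj hij => ?_⟩
  · obtain ⟨z, hz⟩ := mem_latB.1 hu
    obtain ⟨i, hi, hiz⟩ := exists_lt_two_pow z (q - p)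
    refine ⟨i, hi, mem_latB.2 ?_⟩
    have := (two_pow_mul_dvd_iff h _).2 hiz
    convert this using 1
    simp only [Prod.fst_sub, Prod.snd_sub]
    linear_combination hz
  · refine eq_of_two_pow_dvd_sub hi hj ((two_pow_mul_dvd_iff h _).1 ?_)
    simpa [mem_latB, sub_mul] using hij

theorem isTransversal_latL {p q : ℕ} (h : p ≤ q) :
    IsTransversal (latL p) (latL q) (2 ^ (q - p)) fun i => ((i : ℤ) * 2 ^ p, 0) := by
  refine ⟨fun i _ => by simp [mem_latL], fun u hu => ?_, fun i hi j hj hij => ?_⟩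
  · obtain ⟨⟨z, hz⟩, hu2⟩ := hu
    obtain ⟨i, hi, hiz⟩ := exists_lt_two_pow z (q - p)
    refine ⟨i, hi, mem_latL.2 ⟨?_, by simpa using hu2⟩⟩
    have := (two_pow_mul_dvd_iff h _).2 hiz
    convert this using 1
    simp only [Prod.fst_sub]
    linear_combination hz
  · refine eq_of_two_pow_dvd_sub hi hj ((two_pow_mul_dvd_iff h _).1 ?_)
    simpa [mem_latL, sub_mul] using hij

theorem isTransversal_latB_zero_latL_self (p : ℕ) :
    IsTransversal (latB 0 p) (latL p) 2 fun i => (0, (i : ℤ)) := by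
  refine ⟨fun i _ => by simp [mem_latB], fun ⟨x, y⟩ hu => ?_, fun i hi j hj hij => ?_⟩
  · obtain ⟨i, hi, hiy⟩ := exists_lt_two_pow y 1
    exact ⟨i, hi, mem_latL.2 ⟨by simpa [mem_latB] using hu, by simpa using hiy⟩⟩
  · exact eq_of_two_pow_dvd_sub (w := 1) hi hj (by simpa [mem_latL] using hij)

/-- The quotient is a product of cyclic groups of orders `2 ^ (q - p)` and `2`; one number `i`
encodes both coordinates as `i / 2` and `i % 2`. -/
theorem isTransversal_latB_zero_latL {p q : ℕ} (h : p ≤ q) :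
    IsTransversal (latB 0 p) (latL q) (2 ^ (q - p + 1))
      fun i => (((i / 2 : ℕ) : ℤ) * 2 ^ p, ((i % 2 : ℕ) : ℤ)) := by
  refine ⟨fun i _ => by simp [mem_latB], fun ⟨x, y⟩ hu => ?_, fun i hi j hj hij => ?_⟩
  · obtain ⟨z, hz⟩ : (2 : ℤ) ^ p ∣ x := by simpa [mem_latB] using hu
    obtain ⟨i, hi, hiz⟩ := exists_lt_two_pow z (q - p)
    obtain ⟨j, hj, hjy⟩ := exists_lt_two_pow y 1
    rw [pow_one] at hj hjy
    have h1 : (2 * i + j) / 2 = i := by omega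
    have h2 : (2 * i + j) % 2 = j := by omega
    refine ⟨2 * i + j, by rw [pow_succ]; omega, mem_latL.2 ?_⟩
    simp only [h1, h2, Prod.mk_sub_mk]
    refine ⟨?_, hjy⟩
    have := (two_pow_mul_dvd_iff h _).2 hiz
    rwa [hz, mul_comm, ← sub_mul]
  · simp only [mem_latL, Prod.mk_sub_mk, ← sub_mul, two_pow_mul_dvd_iff h] at hij
    rw [pow_succ] at hi hj
    have h1 := eq_of_two_pow_dvd_sub (by omega) (by omega) hij.1
    omega

/-- Here the quotient is cyclic, generated by `(2 ^ (p - 1), 1)`. -/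
theorem isTransversal_latB_latL {p q : ℕ} (hp : 1 ≤ p) (h : p ≤ q) :
    IsTransversal (latB (2 ^ (p - 1)) p) (latL q) (2 ^ (q - p + 1))
      fun i => ((i : ℤ) * 2 ^ (p - 1), (i : ℤ)) := by
  obtain ⟨p, rfl⟩ := Nat.exists_eq_add_of_le' hp
  have hqp : q - (p + 1) + 1 = q - p := by omega
  simp only [Nat.add_sub_cancel, hqp]
  refine ⟨fun i _ => mem_latB.2 ⟨0, by simp; ring⟩, fun ⟨x, y⟩ hu => ?_, fun i hi j hj hij => ?_⟩
  · obtain ⟨z, hz⟩ := mem_latB.1 hu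
    simp only at hz
    -- After the shift of `p`, `x = 2 ^ p * (y + 2 * z)`; as `q - p ≥ 1`, the digit also has the
    -- parity of `y`.
    obtain ⟨i, hi, hiz⟩ := exists_lt_two_pow (y + 2 * z) (q - p)
    have h2 : (2 : ℤ) ∣ y + 2 * z - i := (dvd_pow_self 2 (by omega)).trans hiz
    refine ⟨i, hi, mem_latL.2 ⟨?_, ?_⟩⟩
    · have := (two_pow_mul_dvd_iff (show p ≤ q by omega) _).2 hiz
      convert this using 1
      simp only [Prod.mk_sub_mk]
      linear_combination hz
    · simp only [Prod.mk_sub_mk]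
      omega
  · simp only [mem_latL, Prod.mk_sub_mk, ← sub_mul,
      two_pow_mul_dvd_iff (show p ≤ q by omega)] at hij
    exact eq_of_two_pow_dvd_sub hi hj hij.1

/-- A chain of subgroups, of the first kind below the index `s` and of the second kind above. -/
def latT (c : ℤ) (s : ℕ) (b : ℕ → ℕ) (t : ℕ) : AddSubgroup (ℤ × ℤ) :=
  if t < s then latB c (b t) else latL (b t)

theorem latT_of_lt {c : ℤ} {s : ℕ} {b : ℕ → ℕ} {t : ℕ} (h : t < s) :
    latT c s b t = latB c (b t) := if_pos h

theorem latT_of_le {c : ℤ} {s : ℕ} {b : ℕ → ℕ} {t : ℕ} (h : s ≤ t) :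
    latT c s b t = latL (b t) := if_neg (not_lt.2 h)

/-- The digit `i` at the bit position `b t`. -/
def digit (b : ℕ → ℕ) (t i : ℕ) : ℤ × ℤ := ((i : ℤ) * 2 ^ b t, 0)

/-- Digits in two interlaced families of steps from `⊤` down to `latL k`. -/
structure Frame (k n : ℕ) (U V : ℕ → AddSubgroup (ℤ × ℤ)) (N N' : ℕ → ℕ)
    (f f' : ℕ → ℕ → ℤ × ℤ) : Prop where
  zero : U 0 = ⊤
  last : U n = latL k
  le : ∀ t < n, V t ≤ U t
  le' : ∀ t < n, U (t + 1) ≤ V t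
  transversal : ∀ t < n, IsTransversal (U t) (V t) (N t) (f t)
  transversal' : ∀ t < n, IsTransversal (V t) (U (t + 1)) (N' t) (f' t)

theorem IsLevelData.mono {k n r : ℕ} {m l : ℕ → ℕ} (h : IsLevelData k n r m l) {s t : ℕ}
    (hst : s ≤ t) : t ≤ n → m s ≤ m t := by
  induction t, hst using Nat.le_induction with
  | base => exact fun _ => le_rfl
  | succ t hst ih =>
    intro ht
    have := h.2.2.2.2 t ht
    exact (ih (by omega)).trans (by omega)

/-- The exceptional step from `latB` to `latL` lies in the second half of level `r`, which belongs
to `C`: families (a)–(c). -/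
theorem IsLevelData.frame_succ {k n r : ℕ} {m l : ℕ → ℕ} (h : IsLevelData k n r m l) {c : ℤ}
    (hc : (2 : ℤ) ^ (m r + l r) ∣ 2 * c) {Nr : ℕ} {fr : ℕ → ℤ × ℤ}
    (hr : IsTransversal (latB c (m r + l r)) (latL (m (r + 1))) Nr fr) :
    Frame k n (latT c (r + 1) m) (latT c (r + 1) fun t => m t + l t) (fun t => 2 ^ l t)
      (fun t => if t = r then Nr else 2 ^ (m (t + 1) - m t - l t)) (digit m)
      (fun t => if t = r then fr else digit (fun t => m t + l t) t) := by
  obtain ⟨hrn, hm0, hmn, -, hl⟩ := h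
  refine ⟨?_, ?_, fun t ht => ?_, fun t ht => ?_, fun t ht => ?_, fun t ht => ?_⟩
  · rw [latT_of_lt (by omega), hm0, latB_zero]
  · rw [latT_of_le (by omega), hmn]
  · rcases lt_or_ge t (r + 1) with h1 | h1
    · rw [latT_of_lt h1, latT_of_lt h1]
      exact latB_anti (by omega)
    · rw [latT_of_le h1, latT_of_le h1]
      exact latL_anti (by omega)
  · rcases lt_trichotomy t r with h1 | rfl | h1
    · rw [latT_of_lt (by omega), latT_of_lt (by omega)]
      exact latB_anti (hl t ht)
    · rw [latT_of_le le_rfl, latT_of_lt (by omega)]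
      exact latL_le_latB hc (hl t ht)
    · rw [latT_of_le (by omega), latT_of_le (by omega)]
      exact latL_anti (hl t ht)
  · rw [show 2 ^ l t = 2 ^ (m t + l t - m t) by rw [Nat.add_sub_cancel_left]]
    rcases lt_or_ge t (r + 1) with h1 | h1
    · rw [latT_of_lt h1, latT_of_lt h1]
      exact isTransversal_latB c (by omega)
    · rw [latT_of_le h1, latT_of_le h1]
      exact isTransversal_latL (by omega)
  · rcases lt_trichotomy t r with h1 | rfl | h1
    · rw [latT_of_lt (by omega), latT_of_lt (by omega), if_neg h1.ne, if_neg h1.ne, Nat.sub_sub]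
      exact isTransversal_latB c (hl t ht)
    · rw [latT_of_le le_rfl, latT_of_lt (by omega), if_pos rfl, if_pos rfl]
      exact hr
    · rw [latT_of_le (by omega), latT_of_le (by omega), if_neg h1.ne', if_neg h1.ne', Nat.sub_sub]
      exact isTransversal_latL (hl t ht)

/-- The exceptional step lies in the first half of level `r`, which belongs to `S₀`: families
(d)–(f). -/
theorem IsLevelData.frame {k n r : ℕ} {m l : ℕ → ℕ} (h : IsLevelData k n r m l) {c : ℤ}
    (hc : (2 : ℤ) ^ m r ∣ 2 * c) {Nr : ℕ} {fr : ℕ → ℤ × ℤ}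
    (hr : IsTransversal (latB c (m r)) (latL (m r + l r)) Nr fr) :
    Frame k n (latT c (r + 1) m) (latT c r fun t => m t + l t)
      (fun t => if t = r then Nr else 2 ^ l t) (fun t => 2 ^ (m (t + 1) - m t - l t))
      (fun t => if t = r then fr else digit m t) (digit fun t => m t + l t) := by
  obtain ⟨hrn, hm0, hmn, -, hl⟩ := h
  refine ⟨?_, ?_, fun t ht => ?_, fun t ht => ?_, fun t ht => ?_, fun t ht => ?_⟩
  · rw [latT_of_lt (by omega), hm0, latB_zero]
  · rw [latT_of_le (by omega), hmn]
  · rcases lt_trichotomy t r with h1 | rfl | h1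
    · rw [latT_of_lt h1, latT_of_lt (by omega)]
      exact latB_anti (by omega)
    · rw [latT_of_le le_rfl, latT_of_lt (by omega)]
      exact latL_le_latB hc (by omega)
    · rw [latT_of_le h1.le, latT_of_le h1]
      exact latL_anti (by omega)
  · rcases lt_or_ge t r with h1 | h1
    · rw [latT_of_lt (by omega), latT_of_lt h1]
      exact latB_anti (hl t ht)
    · rw [latT_of_le (by omega), latT_of_le h1]
      exact latL_anti (hl t ht)
  · have h2 : 2 ^ l t = 2 ^ (m t + l t - m t) := by rw [Nat.add_sub_cancel_left]
    rcases lt_trichotomy t r with h1 | rfl | h1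
    · rw [latT_of_lt h1, latT_of_lt (by omega), if_neg h1.ne, if_neg h1.ne, h2]
      exact isTransversal_latB c (by omega)
    · rw [latT_of_le le_rfl, latT_of_lt (by omega), if_pos rfl, if_pos rfl]
      exact hr
    · rw [latT_of_le h1.le, latT_of_le h1, if_neg h1.ne', if_neg h1.ne', h2]
      exact isTransversal_latL (by omega)
  · rw [Nat.sub_sub]
    rcases lt_or_ge t r with h1 | h1
    · rw [latT_of_lt h1, latT_of_lt (by omega)]
      exact isTransversal_latB c (hl t ht)
    · rw [latT_of_le h1, latT_of_le (by omega)]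
      exact isTransversal_latL (hl t ht)

theorem Frame.tilesMod {k n : ℕ} {U V : ℕ → AddSubgroup (ℤ × ℤ)} {N N' : ℕ → ℕ}
    {f f' : ℕ → ℕ → ℤ × ℤ} (F : Frame k n U V N N' f f') {A C : Set (ℤ × ℤ)}
    (hA0 : A.Nonempty) (hC0 : C.Nonempty)
    {ψ ψ' : ℕ → (ℕ → ℕ) → ℤ × ℤ} (hψ : IsAdapted ψ) (hψ' : IsAdapted ψ')
    (hψV : ∀ t < n, ∀ i, ψ t i ∈ V t) (hψU : ∀ t < n, ∀ i, ψ' t i ∈ U (t + 1))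
    (hA : ∀ g, g ∈ A ↔ ∃ i : ℕ → ℕ, (∀ t < n, i t < N t) ∧ g - digitSum f ψ n i ∈ latL k)
    (hC : ∀ g, g ∈ C ↔ ∃ i : ℕ → ℕ, (∀ t < n, i t < N' t) ∧ g - digitSum f' ψ' n i ∈ latL k) :
    TilesMod (latL k) A C := by
  obtain ⟨-, hA1⟩ := adapted_of_digits F.le F.le' F.transversal hψV hψ (by rwa [F.last])
  -- The chain for `C` is shifted by half a level: it starts at `V 0` and is closed by `U n`.
  let V' : ℕ → AddSubgroup (ℤ × ℤ) := fun t => if t < n then V t else U n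
  have hV' : ∀ t < n, V' t = V t := fun t ht => if_pos ht
  obtain ⟨hC1, hC2⟩ := adapted_of_digits (A := C) (U := V') (V := fun t => U (t + 1))
    (n := n) (N := N') (f := f') (ψ := ψ')
    (fun t ht => by rw [hV' t ht]; exact F.le' t ht)
    (fun t ht => by
      rcases Nat.lt_or_ge (t + 1) n with h | h
      · rw [hV' _ h]; exact F.le _ h
      · have : t + 1 = n := by omega
        simp [V', this])
    (fun t ht => by rw [hV' t ht]; exact F.transversal' t ht) hψU hψ'
    (by simpa [V', F.last] using hC)
  have := tilesMod_of_chain F.zero F.le F.le' hA0 hC0 (fun t ht => (hA1 t ht).1)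
    (fun t ht => (hA1 t ht).2) (fun t ht => ?_) (fun t ht => by
      have := (hC2 t ht).1
      rwa [hV' t ht] at this)
  · rwa [F.last] at this
  · rw [← hV' t ht]
    cases t with
    -- Rigidity of `C` from `U 0 = ⊤` to `V 0` is just `C ⊆ V 0`.
    | zero => exact fun a ha a' ha' _ => (V' 0).sub_mem (hC1 a ha) (hC1 a' ha')
    | succ t => exact (hC2 t (by omega)).2

end Frames

/-! ### Perfect codes as tilings -/

section Codes

/-- The projection `ℤ × ℤ → ℤ_{2^k} × ℤ_2`. -/
def toGHom (k : ℕ) : ℤ × ℤ →+ ZMod (2 ^ k) × ZMod 2 where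
  toFun g := toG k g.1 g.2
  map_zero' := by simp [toG]
  map_add' a b := by simp [toG]

theorem toGHom_apply (k : ℕ) (g : ℤ × ℤ) : toGHom k g = toG k g.1 g.2 := rfl

theorem toGHom_surjective (k : ℕ) : Function.Surjective (toGHom k) := fun ⟨x, y⟩ => by
  obtain ⟨z, rfl⟩ := ZMod.intCast_surjective x
  obtain ⟨w, rfl⟩ := ZMod.intCast_surjective y
  exact ⟨(z, w), rfl⟩

theorem toGHom_eq_zero_iff {k : ℕ} {g : ℤ × ℤ} : toGHom k g = 0 ↔ g ∈ latL k := by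
  have h1 := ZMod.intCast_zmod_eq_zero_iff_dvd g.1 (2 ^ k)
  have h2 := ZMod.intCast_zmod_eq_zero_iff_dvd g.2 2
  push_cast at h1 h2
  rw [mem_latL, ← h1, ← h2]
  simp [toGHom, toG, Prod.ext_iff]

theorem toGHom_eq_iff {k : ℕ} {g g' : ℤ × ℤ} : toGHom k g = toGHom k g' ↔ g - g' ∈ latL k := by
  rw [← toGHom_eq_zero_iff, map_sub, sub_eq_zero]

/-- The vertex `u` covers `v` exactly if `v - u ∈ S ∪ {0}`, so a unique covering vertex in `C` is a
unique decomposition of `v`. -/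
theorem isPerfectCode_iff_tilesMod {k : ℕ} {S C : Set (ZMod (2 ^ k) × ZMod 2)} :
    IsPerfectCode (cayleyDigraph S) C ↔
      TilesMod (latL k) (toGHom k ⁻¹' (S ∪ {0})) (toGHom k ⁻¹' C) := by
  have hadj : ∀ u v : ZMod (2 ^ k) × ZMod 2,
      (u = v ∨ (cayleyDigraph S).Adj u v) ↔ v - u ∈ S ∪ {0} := by
    intro u v
    simp only [cayleyDigraph, Set.mem_union, Set.mem_singleton_iff, sub_eq_zero]
    rw [or_comm, eq_comm]
  simp only [IsPerfectCode, hadj]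
  constructor
  · intro h
    refine ⟨fun g => ?_, fun a ha a' ha' b hb b' hb' hab => ?_⟩
    · obtain ⟨u, ⟨hu, hgu⟩, -⟩ := h (toGHom k g)
      obtain ⟨b, rfl⟩ := toGHom_surjective k u
      refine ⟨g - b, ?_, b, hu, by simp⟩
      rwa [Set.mem_preimage, map_sub]
    · have h1 := toGHom_eq_iff.2 hab
      have h2 : toGHom k b = toGHom k b' := by
        refine (h (toGHom k (a + b))).unique ⟨hb, ?_⟩ ⟨hb', ?_⟩
        · rwa [map_add, add_sub_cancel_right]
        · rwa [h1, map_add, add_sub_cancel_right]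
      rw [map_add, map_add, h2] at h1
      exact ⟨toGHom_eq_iff.1 (add_right_cancel h1), toGHom_eq_iff.1 h2⟩
  · intro h v
    obtain ⟨g, rfl⟩ := toGHom_surjective k v
    obtain ⟨a, ha, b, hb, hab⟩ := h.1 g
    have h1 := toGHom_eq_iff.2 hab
    refine ⟨toGHom k b, ⟨hb, ?_⟩, ?_⟩
    · rw [h1, map_add, add_sub_cancel_right]
      exact ha
    · rintro u ⟨hu, hu'⟩
      obtain ⟨b', rfl⟩ := toGHom_surjective k u
      rw [← map_sub] at hu'
      refine toGHom_eq_iff.2 (h.2 (g - b') hu' a ha b' hu b hb ?_).2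
      simpa using hab

end Codes

/-! ### Sums over parts of `range n` -/

section Sums

variable {n r : ℕ}

theorem pre_congr {i i' : ℕ → ℕ} {s : ℕ} (h : ∀ t < s, i t = i' t) : pre i s = pre i' s :=
  List.map_congr_left fun t ht => h t (List.mem_range.1 ht)

theorem sum_range_erase_eq (g : ℕ → ℤ) :
    ∑ t ∈ (range n).erase r, g t = ∑ t ∈ range n, if t = r then 0 else g t := by
  rw [← filter_ne', sum_filter]
  exact sum_congr rfl fun t _ => by split_ifs <;> simp_all

theorem sum_range_eq_sum_ite_lt (hr : r ≤ n) (g : ℕ → ℤ) :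
    ∑ t ∈ range r, g t = ∑ t ∈ range n, if t < r then g t else 0 := by
  rw [← sum_filter]
  congr 1
  ext t
  simp only [mem_range, mem_filter]
  omega

theorem sum_Ico_eq_sum_ite_lt (g : ℕ → ℤ) :
    ∑ t ∈ Ico r n, g t = ∑ t ∈ range n, if t < r then 0 else g t := by
  simp only [← ite_not (_ < r)]
  rw [← sum_filter]
  congr 1
  ext t
  simp only [mem_Ico, mem_range, mem_filter]
  omega

theorem eq_sum_range_ite (hr : r < n) (g : ℕ → ℤ) :
    g r = ∑ t ∈ range n, if t = r then g t else 0 := by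
  rw [sum_ite_eq' (range n) r g, if_pos (mem_range.2 hr)]

theorem eq_sum_range_ite_succ (hr0 : 1 ≤ r) (hr : r < n) (g : ℕ → ℤ) :
    g r = ∑ t ∈ range n, if t + 1 = r then g (t + 1) else 0 := by
  obtain ⟨r, rfl⟩ := Nat.exists_eq_add_of_le' hr0
  simp only [Nat.add_right_cancel_iff]
  exact eq_sum_range_ite (g := fun t => g (t + 1)) (by omega)

end Sums

/-! ### Digit sums in the coordinates of the six families -/

section Digits

variable {n r : ℕ} {m l : ℕ → ℕ}

theorem digitSum_eq {f : ℕ → ℕ → ℤ × ℤ} {ψ : ℕ → (ℕ → ℕ) → ℤ × ℤ} {i : ℕ → ℕ} {x y : ℤ}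
    (hx : x = ∑ t ∈ range n, ((f t (i t)).1 + (ψ t i).1))
    (hy : y = ∑ t ∈ range n, ((f t (i t)).2 + (ψ t i).2)) : digitSum f ψ n i = (x, y) := by
  rw [hx, hy, digitSum]
  ext
  · simp [Prod.fst_sum]
  · simp [Prod.snd_sum]

/-- The value of `β` at `i_0, …, i_t, j`, where `i_r` and `j` are encoded as `2 * i_r + j`; the
index `j` occurs for `t ≥ r` only. -/
def splitVal (β : List ℕ → ℤ) (r t : ℕ) (i : ℕ → ℕ) : ℤ :=
  if t < r then β (pre i (t + 1))
  else β (pre (Function.update i r (i r / 2)) (t + 1) ++ [i r % 2])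

theorem isAdapted_pre (β : List ℕ → ℤ) : IsAdapted fun t i => β (pre i (t + 1)) :=
  fun t i i' h => by
    simp only
    rw [pre_congr (i' := i') fun s hs => h s (by omega)]

theorem isAdapted_splitVal (β : List ℕ → ℤ) (r : ℕ) : IsAdapted (splitVal β r) := by
  intro t i i' h
  unfold splitVal
  split_ifs with ht
  · exact isAdapted_pre β t i i' h
  · rw [h r (by omega)]
    rw [pre_congr (i' := Function.update i' r (i' r / 2)) fun s hs => ?_]
    rcases eq_or_ne s r with rfl | hs'
    · simp
    · simp [hs', h s (by omega)]

/-- Merge the digit `i_r` and `j` into one digit `2 * i_r + j`. -/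
def merge (r : ℕ) (i : ℕ → ℕ) (j : ℕ) : ℕ → ℕ := Function.update i r (2 * i r + j)

theorem merge_self (r : ℕ) (i : ℕ → ℕ) (j : ℕ) : merge r i j r = 2 * i r + j :=
  Function.update_self _ _ _

theorem merge_of_ne {r t : ℕ} (h : t ≠ r) (i : ℕ → ℕ) (j : ℕ) : merge r i j t = i t :=
  Function.update_of_ne h _ _

theorem update_merge {r j : ℕ} (hj : j < 2) (i : ℕ → ℕ) :
    Function.update (merge r i j) r (merge r i j r / 2) = i := by
  ext t
  rcases eq_or_ne t r with rfl | h
  · rw [Function.update_self, merge_self]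
    omega
  · rw [Function.update_of_ne h, merge_of_ne h]

theorem splitVal_merge {β : List ℕ → ℤ} {t j : ℕ} (hj : j < 2) (i : ℕ → ℕ) :
    splitVal β r t (merge r i j) =
      if t < r then β (pre i (t + 1)) else β (pre i (t + 1) ++ [j]) := by
  unfold splitVal
  rw [update_merge hj, merge_self, show (2 * i r + j) % 2 = j by omega]
  split_ifs with h
  · rw [pre_congr (i' := i) fun s hs => merge_of_ne (by omega) i j]
  · rfl

theorem exists_merge {w : ℕ → ℕ} (hr : r < n) {P : (ℕ → ℕ) → Prop} :
    (∃ i : ℕ → ℕ, (∀ t < n, i t < if t = r then 2 ^ (w r + 1) else 2 ^ w t) ∧ P i) ↔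
      ∃ (i : ℕ → ℕ) (j : ℕ), (∀ t < n, i t < 2 ^ w t) ∧ j < 2 ∧ P (merge r i j) := by
  constructor
  · rintro ⟨i, hi, hP⟩
    have h1 := hi r hr
    rw [if_pos rfl, pow_succ] at h1
    refine ⟨Function.update i r (i r / 2), i r % 2, fun t ht => ?_, by omega, ?_⟩
    · rcases eq_or_ne t r with rfl | h
      · rw [Function.update_self]
        omega
      · rw [Function.update_of_ne h]
        simpa [h] using hi t ht
    · convert hP
      ext t
      rcases eq_or_ne t r with rfl | h
      · rw [merge_self, Function.update_self]
        omega
      · rw [merge_of_ne h, Function.update_of_ne h]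
  · rintro ⟨i, j, hi, hj, hP⟩
    refine ⟨_, fun t ht => ?_, hP⟩
    rcases eq_or_ne t r with rfl | h
    · rw [merge_self, if_pos rfl, pow_succ]
      have := hi t ht
      omega
    · rw [merge_of_ne h, if_neg h]
      exact hi t ht

theorem forall_lt_ite_iff (hr : r < n) {N : ℕ → ℕ} {Nr : ℕ} {i : ℕ → ℕ} :
    (∀ t < n, i t < if t = r then Nr else N t) ↔ (∀ t < n, t ≠ r → i t < N t) ∧ i r < Nr := by
  constructor
  · exact fun h => ⟨fun t ht htr => by simpa [htr] using h t ht, by simpa using h r hr⟩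
  · rintro ⟨h1, h2⟩ t ht
    split_ifs with h
    · exact h ▸ h2
    · exact h1 t ht h

/-! ### The coordinates of the elements of the six families -/

theorem digitSum_erase (hr : r < n) (α : List ℕ → ℤ) (e : ℤ) (i : ℕ → ℕ) :
    digitSum (digit m) (fun t i => if t = r then α (pre i (t + 1)) • (e, (1 : ℤ))
      else ((α (pre i (t + 1)) * 2 ^ (m t + l t), 0) : ℤ × ℤ)) n i =
    (∑ t ∈ range n, (i t : ℤ) * 2 ^ m t
      + ∑ t ∈ (range n).erase r, α (pre i (t + 1)) * 2 ^ (m t + l t)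
      + α (pre i (r + 1)) * e, α (pre i (r + 1))) := by
  apply digitSum_eq
  · rw [sum_range_erase_eq, eq_sum_range_ite hr fun t => α (pre i (t + 1)) * e,
      ← sum_add_distrib, ← sum_add_distrib]
    refine sum_congr rfl fun t _ => ?_
    split_ifs <;> simp [digit]
  · rw [eq_sum_range_ite hr fun t => α (pre i (t + 1))]
    refine sum_congr rfl fun t _ => ?_
    split_ifs <;> simp [digit]

theorem digitSum_special (hr : r < n) (b : ℕ → ℕ) (β : List ℕ → ℤ) (b' : ℕ → ℕ) (e : ℤ)
    (i : ℕ → ℕ) :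
    digitSum (fun t => if t = r then fun i => ((i : ℤ) * e, (i : ℤ)) else digit b t)
      (fun t i => ((β (pre i (t + 1)) * 2 ^ b' t, 0) : ℤ × ℤ)) n i =
    (∑ t ∈ (range n).erase r, (i t : ℤ) * 2 ^ b t
      + ∑ t ∈ range n, β (pre i (t + 1)) * 2 ^ b' t + i r * e, (i r : ℤ)) := by
  apply digitSum_eq
  · rw [sum_range_erase_eq, eq_sum_range_ite hr fun t => (i t : ℤ) * e,
      ← sum_add_distrib, ← sum_add_distrib]
    refine sum_congr rfl fun t _ => ?_
    split_ifs <;> simp [digit]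
    ring
  · rw [eq_sum_range_ite hr fun t => (i t : ℤ)]
    refine sum_congr rfl fun t _ => ?_
    split_ifs <;> simp [digit]

theorem digitSum_gamma (hr : r < n) (α γ : List ℕ → ℤ) (i : ℕ → ℕ) :
    digitSum (digit m) (fun t i => (α (pre i (t + 1)) * 2 ^ (m t + l t),
      if t = r then γ (pre i (t + 1)) else 0)) n i =
    (∑ t ∈ range n, ((i t : ℤ) * 2 ^ m t + α (pre i (t + 1)) * 2 ^ (m t + l t)),
      γ (pre i (r + 1))) := by
  apply digitSum_eq
  · exact sum_congr rfl fun t _ => by simp [digit]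
  · rw [eq_sum_range_ite hr fun t => γ (pre i (t + 1))]
    exact sum_congr rfl fun t _ => by simp [digit]

theorem digitSum_split (hr : r < n) (b : ℕ → ℕ) (β : List ℕ → ℤ) (b' : ℕ → ℕ)
    (i : ℕ → ℕ) {j : ℕ} (hj : j < 2) :
    digitSum (fun t => if t = r then fun i => (((i / 2 : ℕ) : ℤ) * 2 ^ b r, ((i % 2 : ℕ) : ℤ))
        else digit b t)
      (fun t i => ((splitVal β r t i * 2 ^ b' t, 0) : ℤ × ℤ)) n (merge r i j) =
    (∑ t ∈ range n, (i t : ℤ) * 2 ^ b t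
      + ∑ t ∈ range r, β (pre i (t + 1)) * 2 ^ b' t
      + ∑ t ∈ Ico r n, β (pre i (t + 1) ++ [j]) * 2 ^ b' t, (j : ℤ)) := by
  apply digitSum_eq
  · rw [sum_range_eq_sum_ite_lt hr.le, sum_Ico_eq_sum_ite_lt,
      ← sum_add_distrib, ← sum_add_distrib]
    refine sum_congr rfl fun t _ => ?_
    rw [splitVal_merge hj]
    rcases eq_or_ne t r with rfl | h
    · simp only [if_true, merge_self, lt_irrefl, if_false]
      rw [show (2 * i t + j) / 2 = i t by omega]
      ring
    · rw [if_neg h, merge_of_ne h]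
      split_ifs <;> simp [digit]
  · rw [eq_sum_range_ite hr fun _ => (j : ℤ)]
    refine sum_congr rfl fun t _ => ?_
    rcases eq_or_ne t r with rfl | h
    · simp only [if_true, merge_self]
      rw [show (2 * i t + j) % 2 = j by omega]
      simp
    · simp [h, digit]

/-- The coefficient with indices before `r` is the correction at level `r - 1`. For `r = 0` there is
no such level, so `β []` has to vanish. -/
theorem digitSum_filter (hr : r < n) {β : List ℕ → ℤ} (hβ : r = 0 → β [] = 0) (e : ℤ)
    (i : ℕ → ℕ) :
    digitSum (digit fun t => m t + l t)
      (fun t i => if t + 1 = r then β (pre i (t + 1)) • (e, (1 : ℤ))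
      else ((β (pre i (t + 1)) * 2 ^ m (t + 1), 0) : ℤ × ℤ)) n i =
    (∑ t ∈ range n, (i t : ℤ) * 2 ^ (m t + l t)
      + ∑ t ∈ (range n).filter (fun t => t + 1 ≠ r), β (pre i (t + 1)) * 2 ^ m (t + 1)
      + β (pre i r) * e, β (pre i r)) := by
  have key : β (pre i r) = ∑ t ∈ range n, if t + 1 = r then β (pre i (t + 1)) else 0 := by
    rcases Nat.eq_zero_or_pos r with rfl | h0
    · simp [pre, hβ rfl]
    · exact eq_sum_range_ite_succ h0 hr fun t => β (pre i t)
  apply digitSum_eq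
  · rw [sum_filter, key, sum_mul, ← sum_add_distrib, ← sum_add_distrib]
    refine sum_congr rfl fun t _ => ?_
    by_cases h : t + 1 = r <;> simp [digit, h]
  · rw [key]
    refine sum_congr rfl fun t _ => ?_
    by_cases h : t + 1 = r <;> simp [digit, h]

theorem digitSum_gamma_pred (hr : r < n) (β γ : List ℕ → ℤ) (i : ℕ → ℕ) :
    digitSum (digit fun t => m t + l t) (fun t i => (β (pre i (t + 1)) * 2 ^ m (t + 1),
      if t + 1 = r then γ (pre i (t + 1)) else 0)) n i =
    (∑ t ∈ range n, ((i t : ℤ) * 2 ^ (m t + l t) + β (pre i (t + 1)) * 2 ^ m (t + 1)),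
      if r = 0 then 0 else γ (pre i r)) := by
  apply digitSum_eq
  · exact sum_congr rfl fun t _ => by simp [digit]
  · rcases Nat.eq_zero_or_pos r with rfl | h0
    · simp [digit]
    · rw [if_neg h0.ne', eq_sum_range_ite_succ h0 hr fun t => γ (pre i t)]
      exact sum_congr rfl fun t _ => by simp [digit]

end Digits

/-! ### Every family is a tiling -/

section Converse

variable {k n r : ℕ} {m l : ℕ → ℕ} {S₀ C : Set (ZMod (2 ^ k) × ZMod 2)}

theorem mem_preimage_toGHom_iff {X : Set (ZMod (2 ^ k) × ZMod 2)} {P : (ℕ → ℕ) → Prop}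
    {D : (ℕ → ℕ) → ℤ × ℤ} (hX : ∀ g, g ∈ X ↔ ∃ i, P i ∧ g = toGHom k (D i)) (g : ℤ × ℤ) :
    g ∈ toGHom k ⁻¹' X ↔ ∃ i, P i ∧ g - D i ∈ latL k := by
  rw [Set.mem_preimage, hX]
  simp only [toGHom_eq_iff]

theorem Frame.tilesMod_preimage {U V : ℕ → AddSubgroup (ℤ × ℤ)} {N N' : ℕ → ℕ}
    {f f' : ℕ → ℕ → ℤ × ℤ} (F : Frame k n U V N N' f f') (hS0 : 0 ∈ S₀) (hC0 : 0 ∈ C)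
    {ψ ψ' : ℕ → (ℕ → ℕ) → ℤ × ℤ} (hψ : IsAdapted ψ) (hψ' : IsAdapted ψ')
    (hψV : ∀ t < n, ∀ i, ψ t i ∈ V t) (hψU : ∀ t < n, ∀ i, ψ' t i ∈ U (t + 1))
    (hS : ∀ g, g ∈ S₀ ↔ ∃ i : ℕ → ℕ, (∀ t < n, i t < N t) ∧ g = toGHom k (digitSum f ψ n i))
    (hC : ∀ g, g ∈ C ↔ ∃ i : ℕ → ℕ, (∀ t < n, i t < N' t) ∧ g = toGHom k (digitSum f' ψ' n i)) :
    TilesMod (latL k) (toGHom k ⁻¹' S₀) (toGHom k ⁻¹' C) :=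
  F.tilesMod ⟨0, by simpa using hS0⟩ ⟨0, by simpa using hC0⟩ hψ hψ' hψV hψU
    (mem_preimage_toGHom_iff hS) (mem_preimage_toGHom_iff hC)

theorem IsAdapted.comp {M M' : Type*} {ψ : ℕ → (ℕ → ℕ) → M} (h : IsAdapted ψ) (F : ℕ → M → M') :
    IsAdapted fun t i => F t (ψ t i) :=
  fun t i i' hi => congrArg (F t) (h t i i' hi)

theorem mem_latT {c : ℤ} {s : ℕ} {b : ℕ → ℕ} {t : ℕ} (z : ℤ) :
    ((z * 2 ^ b t, 0) : ℤ × ℤ) ∈ latT c s b t := by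
  unfold latT
  split_ifs
  · simp [mem_latB]
  · simp [mem_latL]

theorem smul_mem_latB (z c : ℤ) (p : ℕ) : z • ((c, 1) : ℤ × ℤ) ∈ latB c p :=
  (latB c p).zsmul_mem (by simp [mem_latB]) z

theorem FamilyA.tilesMod (h : IsLevelData k n r m l) (hS0 : 0 ∈ S₀) (hC0 : 0 ∈ C)
    (H : FamilyA k n r m l S₀ C) : TilesMod (latL k) (toGHom k ⁻¹' S₀) (toGHom k ⁻¹' C) := by
  obtain ⟨-, hd, α, β, -, -, hS, hC⟩ := H
  have hr := h.1
  -- The factor `0` puts the digit into the form required by `digitSum_special`, with `e = 0`.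
  refine (h.frame_succ (c := 0) (by simp) (Nr := 2) (fr := fun i => ((i : ℤ) * 0, (i : ℤ)))
    ?_).tilesMod_preimage hS0 hC0
    (ψ := fun t i => if t = r then α (pre i (t + 1)) • (0, (1 : ℤ))
      else ((α (pre i (t + 1)) * 2 ^ (m t + l t), 0) : ℤ × ℤ))
    (ψ' := fun t i => ((β (pre i (t + 1)) * 2 ^ m (t + 1), 0) : ℤ × ℤ))
    ((isAdapted_pre α).comp fun t z => if t = r then z • (0, (1 : ℤ)) else (z * 2 ^ (m t + l t), 0))
    ((isAdapted_pre β).comp fun t z => (z * 2 ^ m (t + 1), 0)) ?_ ?_ ?_ ?_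
  · rw [← hd]
    simpa using isTransversal_latB_zero_latL_self (m r + l r)
  · intro t ht i
    split_ifs with htr
    · rw [latT_of_lt (by omega)]
      exact smul_mem_latB _ _ _
    · exact mem_latT _
  · exact fun t ht i => mem_latT _
  · intro g
    rw [hS]
    simp only [Set.mem_ofPred_eq, digitSum_erase hr, toGHom_apply, mul_zero, add_zero]
  · intro g
    rw [hC]
    simp only [Set.mem_ofPred_eq, digitSum_special hr, toGHom_apply, forall_lt_ite_iff hr,
      and_assoc]
    simp only [mul_zero, add_zero]

theorem FamilyB.tilesMod (h : IsLevelData k n r m l) (hS0 : 0 ∈ S₀) (hC0 : 0 ∈ C)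
    (H : FamilyB k n r m l S₀ C) : TilesMod (latL k) (toGHom k ⁻¹' S₀) (toGHom k ⁻¹' C) := by
  obtain ⟨-, hd, α, β, -, -, hS, hC⟩ := H
  have hr := h.1
  refine (h.frame_succ (c := 2 ^ (m r + l r - 1)) ?_
    (isTransversal_latB_latL hd (h.2.2.2.2 r hr))).tilesMod_preimage hS0 hC0
    (ψ := fun t i => if t = r then α (pre i (t + 1)) • (2 ^ (m r + l r - 1), (1 : ℤ))
      else ((α (pre i (t + 1)) * 2 ^ (m t + l t), 0) : ℤ × ℤ))
    (ψ' := fun t i => ((β (pre i (t + 1)) * 2 ^ m (t + 1), 0) : ℤ × ℤ))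
    ((isAdapted_pre α).comp fun t z => if t = r then z • (2 ^ (m r + l r - 1), (1 : ℤ))
      else (z * 2 ^ (m t + l t), 0))
    ((isAdapted_pre β).comp fun t z => (z * 2 ^ m (t + 1), 0)) ?_ ?_ ?_ ?_
  · rw [← pow_succ', Nat.sub_add_cancel hd]
  · intro t ht i
    split_ifs with htr
    · rw [latT_of_lt (by omega)]
      exact smul_mem_latB _ _ _
    · exact mem_latT _
  · exact fun t ht i => mem_latT _
  · intro g
    rw [hS]
    simp only [Set.mem_ofPred_eq, digitSum_erase hr, toGHom_apply]
  · intro g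
    rw [hC]
    simp only [Set.mem_ofPred_eq, digitSum_special hr, toGHom_apply,
      forall_lt_ite_iff hr, and_assoc, Nat.sub_sub]

theorem FamilyC.tilesMod (h : IsLevelData k n r m l) (hS0 : 0 ∈ S₀) (hC0 : 0 ∈ C)
    (H : FamilyC k n r m l S₀ C) : TilesMod (latL k) (toGHom k ⁻¹' S₀) (toGHom k ⁻¹' C) := by
  obtain ⟨-, α, β, γ, -, -, hS, hC⟩ := H
  have hr := h.1
  refine (h.frame_succ (c := 0) (by simp)
    (isTransversal_latB_zero_latL (h.2.2.2.2 r hr))).tilesMod_preimage hS0 hC0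
    (ψ := fun t i => (α (pre i (t + 1)) * 2 ^ (m t + l t), if t = r then γ (pre i (t + 1)) else 0))
    (ψ' := fun t i => ((splitVal β r t i * 2 ^ m (t + 1), 0) : ℤ × ℤ)) ?_
    ((isAdapted_splitVal β r).comp fun t z => (z * 2 ^ m (t + 1), 0)) ?_ ?_ ?_ ?_
  · intro t i i' hi
    simp only
    rw [pre_congr (i' := i') fun s hs => hi s (by omega)]
  · intro t ht i
    split_ifs with htr
    · rw [latT_of_lt (by omega)]
      simp [mem_latB]
    · exact mem_latT _
  · exact fun t ht i => mem_latT _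
  · intro g
    rw [hS]
    simp only [Set.mem_ofPred_eq, digitSum_gamma hr, toGHom_apply]
  · intro g
    rw [hC]
    simp only [Nat.sub_sub]
    rw [exists_merge (w := fun t => m (t + 1) - (m t + l t)) hr]
    simp only [Set.mem_ofPred_eq]
    refine exists_congr fun i => exists_congr fun j => and_congr_right fun _ =>
      and_congr_right fun hj => ?_
    rw [digitSum_split hr (fun t => m t + l t) β (fun t => m (t + 1)) i hj, toGHom_apply]

theorem FamilyD.tilesMod (h : IsLevelData k n r m l) (hS0 : 0 ∈ S₀) (hC0 : 0 ∈ C)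
    (H : FamilyD k n r m l S₀ C) : TilesMod (latL k) (toGHom k ⁻¹' S₀) (toGHom k ⁻¹' C) := by
  obtain ⟨hl, α, β, -, hβ, hS, hC⟩ := H
  have hr := h.1
  refine (h.frame (c := 0) (by simp) (Nr := 2) (fr := fun i => ((i : ℤ) * 0, (i : ℤ)))
    ?_).tilesMod_preimage hS0 hC0
    (ψ := fun t i => ((α (pre i (t + 1)) * 2 ^ (m t + l t), 0) : ℤ × ℤ))
    (ψ' := fun t i => if t + 1 = r then β (pre i (t + 1)) • (0, (1 : ℤ))
      else ((β (pre i (t + 1)) * 2 ^ m (t + 1), 0) : ℤ × ℤ))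
    ((isAdapted_pre α).comp fun t z => (z * 2 ^ (m t + l t), 0))
    ((isAdapted_pre β).comp fun t z => if t + 1 = r then z • (0, (1 : ℤ))
      else (z * 2 ^ m (t + 1), 0)) ?_ ?_ ?_ ?_
  · rw [hl, add_zero]
    simpa using isTransversal_latB_zero_latL_self (m r)
  · exact fun t ht i => mem_latT _
  · intro t ht i
    split_ifs with htr
    · rw [latT_of_lt (by omega)]
      exact smul_mem_latB _ _ _
    · exact mem_latT _
  · intro g
    rw [hS]
    simp only [Set.mem_ofPred_eq, digitSum_special hr, toGHom_apply, forall_lt_ite_iff hr,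
      and_assoc]
    simp only [mul_zero, add_zero]
  · intro g
    rw [hC]
    simp only [Set.mem_ofPred_eq, digitSum_filter hr (fun _ => hβ 0), toGHom_apply, mul_zero,
      add_zero]

theorem IsLevelData.one_le (h : IsLevelData k n r m l) (hr0 : 1 ≤ r) : 1 ≤ m r := by
  have h1 := (h.2.2.2.1 0 (by have := h.1; omega) (by omega)).1
  have h2 := h.mono (s := 0 + 1) hr0 h.1.le
  omega

theorem FamilyE.tilesMod (h : IsLevelData k n r m l) (hS0 : 0 ∈ S₀) (hC0 : 0 ∈ C)
    (H : FamilyE k n r m l S₀ C) : TilesMod (latL k) (toGHom k ⁻¹' S₀) (toGHom k ⁻¹' C) := by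
  obtain ⟨hr0, α, β, -, hβ, hS, hC⟩ := H
  have hr := h.1
  have hd := h.one_le hr0
  have htr := isTransversal_latB_latL hd (Nat.le_add_right (m r) (l r))
  rw [Nat.add_sub_cancel_left] at htr
  refine (h.frame (c := 2 ^ (m r - 1)) ?_ htr).tilesMod_preimage hS0 hC0
    (ψ := fun t i => ((α (pre i (t + 1)) * 2 ^ (m t + l t), 0) : ℤ × ℤ))
    (ψ' := fun t i => if t + 1 = r then β (pre i (t + 1)) • (2 ^ (m r - 1), (1 : ℤ))
      else ((β (pre i (t + 1)) * 2 ^ m (t + 1), 0) : ℤ × ℤ))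
    ((isAdapted_pre α).comp fun t z => (z * 2 ^ (m t + l t), 0))
    ((isAdapted_pre β).comp fun t z => if t + 1 = r then z • (2 ^ (m r - 1), (1 : ℤ))
      else (z * 2 ^ m (t + 1), 0)) ?_ ?_ ?_ ?_
  · rw [← pow_succ', Nat.sub_add_cancel hd]
  · exact fun t ht i => mem_latT _
  · intro t ht i
    split_ifs with htr
    · rw [latT_of_lt (by omega)]
      exact smul_mem_latB _ _ _
    · exact mem_latT _
  · intro g
    rw [hS]
    simp only [Set.mem_ofPred_eq, digitSum_special hr, toGHom_apply,
      forall_lt_ite_iff hr, and_assoc]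
  · intro g
    rw [hC]
    simp only [Set.mem_ofPred_eq, digitSum_filter hr (fun _ => hβ 0), toGHom_apply]

theorem FamilyF.tilesMod (h : IsLevelData k n r m l) (hS0 : 0 ∈ S₀) (hC0 : 0 ∈ C)
    (H : FamilyF k n r m l S₀ C) : TilesMod (latL k) (toGHom k ⁻¹' S₀) (toGHom k ⁻¹' C) := by
  obtain ⟨-, α, β, γ, -, -, hS, hC⟩ := H
  have hr := h.1
  -- For `r = 0` no level carries the constant `γ []`; it is even because `0 ∈ C`.
  have hγ : ∀ i : ℕ → ℕ, ((γ (pre i r) : ℤ) : ZMod 2)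
      = ((if r = 0 then 0 else γ (pre i r) : ℤ) : ZMod 2) := by
    intro i
    split_ifs with h0
    · subst h0
      rw [hC] at hC0
      obtain ⟨i', -, h0⟩ := hC0
      have := congrArg Prod.snd h0
      simpa [toG, pre] using this.symm
    · rfl
  have htr := isTransversal_latB_zero_latL (Nat.le_add_right (m r) (l r))
  rw [Nat.add_sub_cancel_left] at htr
  refine (h.frame (c := 0) (by simp) htr).tilesMod_preimage hS0 hC0
    (ψ := fun t i => ((splitVal α r t i * 2 ^ (m t + l t), 0) : ℤ × ℤ))
    (ψ' := fun t i => (β (pre i (t + 1)) * 2 ^ m (t + 1),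
      if t + 1 = r then γ (pre i (t + 1)) else 0))
    ((isAdapted_splitVal α r).comp fun t z => (z * 2 ^ (m t + l t), 0)) ?_ ?_ ?_ ?_ ?_
  · intro t i i' hi
    simp only
    rw [pre_congr (i' := i') fun s hs => hi s (by omega)]
  · exact fun t ht i => mem_latT _
  · intro t ht i
    split_ifs with htr
    · rw [latT_of_lt (by omega)]
      simp [mem_latB]
    · exact mem_latT _
  · intro g
    rw [hS, exists_merge (w := l) hr]
    simp only [Set.mem_ofPred_eq]
    refine exists_congr fun i => exists_congr fun j => and_congr_right fun _ =>
      and_congr_right fun hj => ?_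
    rw [digitSum_split hr m α (fun t => m t + l t) i hj, toGHom_apply]
  · intro g
    rw [hC]
    simp only [Set.mem_ofPred_eq, digitSum_gamma_pred hr, toGHom_apply, toG, hγ]

end Converse

/-! ### Corrections as functions of index tuples -/

section Coefficients

variable {Γ M : Type*} [AddCommGroup Γ] [Zero M]

theorem length_pre (i : ℕ → ℕ) (s : ℕ) : (pre i s).length = s := by simp [pre]

theorem getD_pre {i : ℕ → ℕ} {s t : ℕ} (h : t < s) : (pre i s).getD t 0 = i t := by
  simp [pre, h]

theorem getD_replicate (s t : ℕ) : (List.replicate s 0).getD t 0 = 0 := by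
  rw [List.getD_eq_getElem?_getD, List.getElem?_replicate]
  split_ifs <;> rfl

/-- The length of the tuple recovers the level `t`. Choosing `0` whenever the correction vanishes
gives the normalization. -/
theorem exists_coefficients {ψ : ℕ → (ℕ → ℕ) → Γ} (hψ : IsAdapted ψ) (v : ℕ → M → Γ)
    (hv : ∀ t, v t 0 = 0) (hmem : ∀ t i, ψ t i ∈ Set.range (v t))
    (h0 : ∀ t, ψ t (fun _ => 0) = 0) :
    ∃ α : List ℕ → M, (∀ s, α (List.replicate s 0) = 0) ∧
      ∀ t i, ψ t i = v t (α (pre i (t + 1))) := by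
  classical
  choose z hz using hmem
  refine ⟨fun L => if ψ (L.length - 1) (fun t => L.getD t 0) = 0 then 0
    else z (L.length - 1) (fun t => L.getD t 0), fun s => ?_, fun t i => ?_⟩
  · simp only [getD_replicate, h0, if_true]
  · have h1 : ψ t (fun s => (pre i (t + 1)).getD s 0) = ψ t i :=
      hψ t _ _ fun s hs => getD_pre (by omega)
    simp only [length_pre, Nat.add_sub_cancel]
    split_ifs with h
    · rw [hv, ← h1, h]
    · rw [hz, h1]

/-- Family (c) lists `i_r` and `j` separately: a tuple longer than `r` is read as ending in `j`,
which is merged back into the digit `2 * i_r + j`. -/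
theorem exists_splitVal_eq {α : List ℕ → ℤ} (hα : IsNormalized α) (r : ℕ) :
    ∃ β : List ℕ → ℤ, IsNormalized β ∧ ∀ t i, splitVal β r t i = α (pre i (t + 1)) := by
  refine ⟨fun L => if L.length ≤ r then α L
    else α (pre (merge r (fun s => L.getD s 0) (L.getD (L.length - 1) 0)) (L.length - 1)),
    fun s => ?_, fun t i => ?_⟩
  · simp only [getD_replicate, List.length_replicate]
    split_ifs
    · exact hα s
    · rw [← hα (s - 1)]
      congr 1
      rw [pre_congr (i' := fun _ => 0) fun t _ => ?_]
      · simp [pre]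
      · by_cases h : t = r
        · rw [h, merge_self]
        · rw [merge_of_ne h]
  · unfold splitVal
    split_ifs with h
    · simp only [length_pre]
      rw [if_pos (by omega)]
    · simp only [List.length_append, length_pre, List.length_singleton]
      rw [if_neg (by omega), Nat.add_sub_cancel]
      congr 1
      refine pre_congr fun s hs => ?_
      have h1 : ∀ s < t + 1,
          (pre (Function.update i r (i r / 2)) (t + 1) ++ [i r % 2]).getD s 0
            = Function.update i r (i r / 2) s := by
        intro s hs
        rw [List.getD_append _ _ _ _ (by rwa [length_pre]), getD_pre hs]
      have h2 : (pre (Function.update i r (i r / 2)) (t + 1) ++ [i r % 2]).getD (t + 1) 0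
          = i r % 2 := by
        rw [List.getD_append_right _ _ _ _ (by rw [length_pre])]
        simp [length_pre]
      rcases eq_or_ne s r with rfl | hsr
      · rw [merge_self, h1 s hs, h2, Function.update_self]
        omega
      · rw [merge_of_ne hsr, h1 s hs, Function.update_of_ne hsr]

end Coefficients

/-! ### Families recovered from alternating steps -/

section Digits

variable {k n r : ℕ} {m l : ℕ → ℕ} {S₀ C : Set (ZMod (2 ^ k) × ZMod 2)}

theorem mem_iff_of_mem_preimage_iff {X : Set (ZMod (2 ^ k) × ZMod 2)} {P : (ℕ → ℕ) → Prop}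
    {D : (ℕ → ℕ) → ℤ × ℤ} (h : ∀ g, g ∈ toGHom k ⁻¹' X ↔ ∃ i, P i ∧ g - D i ∈ latL k)
    (g : ZMod (2 ^ k) × ZMod 2) : g ∈ X ↔ ∃ i, P i ∧ g = toGHom k (D i) := by
  obtain ⟨g, rfl⟩ := toGHom_surjective k g
  simp only [toGHom_eq_iff]
  exact h g

theorem add_mem_preimage {X : Set (ZMod (2 ^ k) × ZMod 2)} :
    ∀ a ∈ toGHom k ⁻¹' X, ∀ u ∈ latL k, a + u ∈ toGHom k ⁻¹' X := by
  intro a ha u hu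
  rwa [Set.mem_preimage, map_add, toGHom_eq_zero_iff.2 hu, add_zero]

/-- Digits and corrections for two sets such that the steps of the frame belong alternately to the
one and to the other. -/
theorem Frame.exists_digits {U V : ℕ → AddSubgroup (ℤ × ℤ)} {N N' : ℕ → ℕ}
    {f f' : ℕ → ℕ → ℤ × ℤ} (F : Frame k n U V N N' f f') (hn : 0 < n)
    (hf : ∀ t, f t 0 = 0) (hf' : ∀ t, f' t 0 = 0) (hS0 : 0 ∈ S₀) (hC0 : 0 ∈ C)
    (hS : ∀ t < n, StepBy (toGHom k ⁻¹' S₀) (toGHom k ⁻¹' C) (U t) (V t))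
    (hC : ∀ t < n, StepBy (toGHom k ⁻¹' C) (toGHom k ⁻¹' S₀) (V t) (U (t + 1)))
    {M M' : Type*} [Zero M] [Zero M'] (v : ℕ → M → ℤ × ℤ) (v' : ℕ → M' → ℤ × ℤ)
    (hv0 : ∀ t, v t 0 = 0) (hv0' : ∀ t, v' t 0 = 0)
    (hv : ∀ t < n, ∀ z, v t z ∈ V t) (hv' : ∀ t < n, ∀ z, v' t z ∈ U (t + 1))
    (hvU : ∀ t < n, ∀ g ∈ V t, ∃ z, g - v t z ∈ U (t + 1))
    (hvV : ∀ t, t + 1 < n → ∀ g ∈ U (t + 1), ∃ z, g - v' t z ∈ V (t + 1)) :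
    ∃ (α : List ℕ → M) (β : List ℕ → M'),
      (∀ s, α (List.replicate s 0) = 0) ∧ (∀ s, β (List.replicate s 0) = 0) ∧
      (∀ g, g ∈ S₀ ↔ ∃ i : ℕ → ℕ, (∀ t < n, i t < N t) ∧
        g = toGHom k (digitSum f (fun t i => v t (α (pre i (t + 1)))) n i)) ∧
      ∀ g, g ∈ C ↔ ∃ i : ℕ → ℕ, (∀ t < n, i t < N' t) ∧
        g = toGHom k (digitSum f' (fun t i => v' t (β (pre i (t + 1)))) n i) := by
  have hS0' : (0 : ℤ × ℤ) ∈ toGHom k ⁻¹' S₀ := by simpa using hS0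
  have hC0' : (0 : ℤ × ℤ) ∈ toGHom k ⁻¹' C := by simpa using hC0
  obtain ⟨ψ, h1, h2, h3, h4⟩ := _root_.exists_digits (A := toGHom k ⁻¹' S₀) F.le' F.transversal hf
    (fun t => Set.range (v t)) (fun t => ⟨0, hv0 t⟩)
    (fun t ht g hg => by obtain ⟨z, hz⟩ := hvU t ht g hg; exact ⟨_, ⟨z, rfl⟩, hz⟩)
    (fun t ht w => by rintro ⟨z, rfl⟩; exact hv t ht z) hS0'
    (by rw [F.last]; exact add_mem_preimage) (by simp [F.zero])
    (fun t ht => (hS t ht).1) (fun t ht => (hC t ht).2)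
  let V' : ℕ → AddSubgroup (ℤ × ℤ) := fun t => if t < n then V t else U n
  have hV' : ∀ t < n, V' t = V t := fun t ht => if_pos ht
  have hV'n : V' n = U n := if_neg (lt_irrefl n)
  obtain ⟨ψ', h1', h2', h3', h4'⟩ := _root_.exists_digits (A := toGHom k ⁻¹' C)
    (U := V') (V := fun t => U (t + 1)) (N := N') (n := n)
    (fun t ht => by
      rcases Nat.lt_or_ge (t + 1) n with h | h
      · rw [hV' _ h]; exact F.le _ h
      · have : t + 1 = n := by omega
        rw [this, hV'n])
    (fun t ht => by rw [hV' t ht]; exact F.transversal' t ht) hf'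
    (fun t => Set.range (v' t)) (fun t => ⟨0, hv0' t⟩)
    (fun t ht g hg => by
      rcases Nat.lt_or_ge (t + 1) n with h | h
      · obtain ⟨z, hz⟩ := hvV t h g hg
        exact ⟨_, ⟨z, rfl⟩, by rwa [hV' _ h]⟩
      -- At the last level a correction is invisible modulo `U n`, so `0` serves.
      · have htn : t + 1 = n := by omega
        exact ⟨_, ⟨0, rfl⟩, by rw [hv0', sub_zero, htn, hV'n]; rwa [htn] at hg⟩)
    (fun t ht w => by rintro ⟨z, rfl⟩; exact hv' t ht z) hC0'
    (by rw [hV'n, F.last]; exact add_mem_preimage)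
    -- Comparison with `0 ∈ C` turns the rigidity of `C` from `⊤` to `V 0` into `C ⊆ V 0`.
    (fun a ha => by
      have := (hS 0 hn).2 a ha 0 hC0' (by simp [F.zero])
      rw [hV' 0 hn]
      simpa using this)
    (fun t ht => by rw [hV' t ht]; exact (hC t ht).1)
    (fun t ht => by
      rcases Nat.lt_or_ge (t + 1) n with h | h
      · rw [hV' _ h]; exact (hS _ h).2
      · have : t + 1 = n := by omega
        rw [this, hV'n]
        exact Rigid.refl)
  obtain ⟨α, hα0, hα⟩ := exists_coefficients h1 v hv0 h2 h3
  obtain ⟨β, hβ0, hβ⟩ := exists_coefficients h1' v' hv0' h2' h3'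
  obtain rfl : ψ = fun t i => v t (α (pre i (t + 1))) := funext fun t => funext fun i => hα t i
  obtain rfl : ψ' = fun t i => v' t (β (pre i (t + 1))) := funext fun t => funext fun i => hβ t i
  refine ⟨α, β, hα0, hβ0, mem_iff_of_mem_preimage_iff (by rwa [F.last] at h4),
    mem_iff_of_mem_preimage_iff (by rwa [hV'n, F.last] at h4')⟩

theorem exists_sub_mem_latB {c : ℤ} {p : ℕ} (q : ℕ) {g : ℤ × ℤ} (hg : g ∈ latB c p) :
    ∃ z : ℤ, g - (z * 2 ^ p, 0) ∈ latB c q := by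
  obtain ⟨z, hz⟩ := mem_latB.1 hg
  refine ⟨z, mem_latB.2 ⟨0, ?_⟩⟩
  simp only [Prod.fst_sub, Prod.snd_sub]
  linear_combination hz

theorem exists_sub_mem_latL {p : ℕ} (q : ℕ) {g : ℤ × ℤ} (hg : g ∈ latL p) :
    ∃ z : ℤ, g - (z * 2 ^ p, 0) ∈ latL q := by
  obtain ⟨⟨z, hz⟩, h2⟩ := mem_latL.1 hg
  refine ⟨z, mem_latL.2 ⟨⟨0, ?_⟩, by simpa using h2⟩⟩
  simp only [Prod.fst_sub]
  linear_combination hz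

theorem exists_sub_mem_latT {c : ℤ} {s : ℕ} {b : ℕ → ℕ} {t : ℕ} (s' : ℕ) (b' : ℕ → ℕ) (t' : ℕ)
    (h : t < s ↔ t' < s') {g : ℤ × ℤ} (hg : g ∈ latT c s b t) :
    ∃ z : ℤ, g - (z * 2 ^ b t, 0) ∈ latT c s' b' t' := by
  by_cases ht : t < s
  · rw [latT_of_lt ht] at hg
    rw [latT_of_lt (h.1 ht)]
    exact exists_sub_mem_latB _ hg
  · rw [latT_of_le (not_lt.1 ht)] at hg
    rw [latT_of_le (not_lt.1 fun h' => ht (h.2 h'))]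
    exact exists_sub_mem_latL _ hg

theorem digit_zero (b : ℕ → ℕ) (t : ℕ) : digit b t 0 = 0 := by simp [digit]

theorem exists_familyB (h : IsLevelData k n r m l) (hS0 : 0 ∈ S₀) (hC0 : 0 ∈ C)
    (hm : m r < m (r + 1)) (hd : 1 ≤ m r + l r)
    (hS : ∀ t < n, StepBy (toGHom k ⁻¹' S₀) (toGHom k ⁻¹' C)
      (latT (2 ^ (m r + l r - 1)) (r + 1) m t)
      (latT (2 ^ (m r + l r - 1)) (r + 1) (fun t => m t + l t) t))
    (hC : ∀ t < n, StepBy (toGHom k ⁻¹' C) (toGHom k ⁻¹' S₀)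
      (latT (2 ^ (m r + l r - 1)) (r + 1) (fun t => m t + l t) t)
      (latT (2 ^ (m r + l r - 1)) (r + 1) m (t + 1))) : FamilyB k n r m l S₀ C := by
  have hr := h.1
  have hpow : (2 : ℤ) ^ (m r + l r) = 2 * 2 ^ (m r + l r - 1) := by
    rw [← pow_succ', Nat.sub_add_cancel hd]
  obtain ⟨α, β, hα, hβ, h1, h2⟩ := (h.frame_succ (c := 2 ^ (m r + l r - 1)) (by rw [hpow])
    (isTransversal_latB_latL hd (h.2.2.2.2 r hr))).exists_digits (by omega) (digit_zero m)
    (fun t => by split_ifs <;> simp [digit]) hS0 hC0 hS hC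
    (fun t (z : ℤ) => if t = r then z • (2 ^ (m r + l r - 1), (1 : ℤ))
      else ((z * 2 ^ (m t + l t), 0) : ℤ × ℤ)) (fun t (z : ℤ) => (z * 2 ^ m (t + 1), 0))
    (fun t => by split_ifs <;> simp) (fun t => by simp)
    (fun t ht z => by
      split_ifs with htr
      · rw [latT_of_lt (by omega)]
        exact smul_mem_latB _ _ _
      · exact mem_latT _)
    (fun t ht z => mem_latT _)
    (fun t ht g hg => by
      rcases eq_or_ne t r with rfl | htr
      · rw [latT_of_lt (by omega)] at hg
        rw [latT_of_le le_rfl]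
        obtain ⟨z, hz⟩ := mem_latB.1 hg
        -- With `c = 2 ^ (m r + l r - 1)` the first coordinate of `g` is exactly `c * (g.2 + 2 *
        -- z)`.
        refine ⟨g.2 + 2 * z, mem_latL.2 ⟨⟨0, ?_⟩, ⟨-z, ?_⟩⟩⟩
        · simp only [if_true, Prod.fst_sub, Prod.smul_fst, smul_eq_mul]
          linear_combination hz + z * hpow
        · simp only [if_true, Prod.snd_sub, Prod.smul_snd, smul_eq_mul]
          ring
      · simp only [if_neg htr]
        exact exists_sub_mem_latT (b := fun t => m t + l t) _ _ _ (by omega) hg)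
    (fun t ht g hg => exists_sub_mem_latT (b := m) _ _ _ Iff.rfl hg)
  refine ⟨hm, hd, α, β, hα, hβ, ?_, ?_⟩
  · ext g
    rw [h1]
    simp only [Set.mem_ofPred_eq, digitSum_erase hr, toGHom_apply]
  · ext g
    rw [h2]
    simp only [Set.mem_ofPred_eq, digitSum_special hr, toGHom_apply,
      forall_lt_ite_iff hr, and_assoc, Nat.sub_sub]

theorem exists_familyC (h : IsLevelData k n r m l) (hS0 : 0 ∈ S₀) (hC0 : 0 ∈ C)
    (hm : m r < m (r + 1))
    (hS : ∀ t < n, StepBy (toGHom k ⁻¹' S₀) (toGHom k ⁻¹' C)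
      (latT 0 (r + 1) m t) (latT 0 (r + 1) (fun t => m t + l t) t))
    (hC : ∀ t < n, StepBy (toGHom k ⁻¹' C) (toGHom k ⁻¹' S₀)
      (latT 0 (r + 1) (fun t => m t + l t) t) (latT 0 (r + 1) m (t + 1))) :
    FamilyC k n r m l S₀ C := by
  have hr := h.1
  obtain ⟨α, β, hα, hβ, h1, h2⟩ := (h.frame_succ (c := 0) (by simp)
    (isTransversal_latB_zero_latL (h.2.2.2.2 r hr))).exists_digits (by omega) (digit_zero m)
    (fun t => by split_ifs <;> simp [digit]) hS0 hC0 hS hC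
    -- One coefficient in `ℤ × ℤ` carries `α` and, at level `r`, also `γ`.
    (fun t (z : ℤ × ℤ) => (z.1 * 2 ^ (m t + l t), if t = r then z.2 else 0))
    (fun t (z : ℤ) => (z * 2 ^ m (t + 1), 0))
    (fun t => by split_ifs <;> simp) (fun t => by simp)
    (fun t ht z => by
      split_ifs with htr
      · rw [latT_of_lt (by omega)]
        simp [mem_latB]
      · exact mem_latT _)
    (fun t ht z => mem_latT _)
    (fun t ht g hg => by
      rcases eq_or_ne t r with rfl | htr
      · rw [latT_of_lt (by omega)] at hg
        rw [latT_of_le le_rfl]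
        obtain ⟨z, hz⟩ := mem_latB.1 hg
        refine ⟨(z, g.2), mem_latL.2 ⟨⟨0, ?_⟩, ⟨0, ?_⟩⟩⟩
        · simp only [Prod.fst_sub]
          linear_combination hz
        · simp
      · obtain ⟨z, hz⟩ := exists_sub_mem_latT (b := fun t => m t + l t) (r + 1) m (t + 1)
          (by omega) hg
        exact ⟨(z, 0), by simpa [htr] using hz⟩)
    (fun t ht g hg => exists_sub_mem_latT (b := m) _ _ _ Iff.rfl hg)
  obtain ⟨β', hβ', hsplit⟩ := exists_splitVal_eq hβ r
  refine ⟨hm, fun L => (α L).1, β', fun L => (α L).2, fun s => by simp [hα], hβ', ?_, ?_⟩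
  · ext g
    rw [h1]
    simp only [Set.mem_ofPred_eq, digitSum_gamma hr (fun L => (α L).1) fun L => (α L).2,
      toGHom_apply]
  · ext g
    rw [h2]
    simp only [Nat.sub_sub]
    rw [exists_merge (w := fun t => m (t + 1) - (m t + l t)) hr]
    simp only [Set.mem_ofPred_eq, ← hsplit]
    refine exists_congr fun i => exists_congr fun j => and_congr_right fun _ =>
      and_congr_right fun hj => ?_
    rw [digitSum_split hr (fun t => m t + l t) β' (fun t => m (t + 1)) i hj, toGHom_apply]

theorem exists_familyD_or_familyE (h : IsLevelData k n r m l) (hS0 : 0 ∈ S₀) (hC0 : 0 ∈ C)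
    (hl : l r = 0) {c : ℤ} (hc : c = 0 ∨ 1 ≤ r ∧ c = 2 ^ (m r - 1))
    (hS : ∀ t < n, StepBy (toGHom k ⁻¹' S₀) (toGHom k ⁻¹' C)
      (latT c (r + 1) m t) (latT c r (fun t => m t + l t) t))
    (hC : ∀ t < n, StepBy (toGHom k ⁻¹' C) (toGHom k ⁻¹' S₀)
      (latT c r (fun t => m t + l t) t) (latT c (r + 1) m (t + 1))) :
    FamilyD k n r m l S₀ C ∨ FamilyE k n r m l S₀ C := by
  have hr := h.1
  have hdvd : (2 : ℤ) ^ m r ∣ 2 * c := by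
    rcases hc with rfl | ⟨hr0, rfl⟩
    · simp
    · rw [← pow_succ', Nat.sub_add_cancel (h.one_le hr0)]
  have htr : IsTransversal (latB c (m r)) (latL (m r + l r)) 2
      fun i => ((i : ℤ) * c, (i : ℤ)) := by
    rw [hl, add_zero]
    rcases hc with rfl | ⟨hr0, rfl⟩
    · simpa using isTransversal_latB_zero_latL_self (m r)
    · simpa using isTransversal_latB_latL (h.one_le hr0) le_rfl
  obtain ⟨α, β, hα, hβ, h1, h2⟩ := (h.frame hdvd htr).exists_digits (by omega)
    (fun t => by split_ifs <;> simp [digit]) (digit_zero _) hS0 hC0 hS hC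
    (fun t (z : ℤ) => (z * 2 ^ (m t + l t), 0))
    -- The multiples of `(c, 1)` represent `latB c (m r)` modulo `latL (m r)`.
    (fun t (z : ℤ) => if t + 1 = r then z • (c, (1 : ℤ))
      else ((z * 2 ^ m (t + 1), 0) : ℤ × ℤ))
    (fun t => by simp) (fun t => by split_ifs <;> simp)
    (fun t ht z => mem_latT _)
    (fun t ht z => by
      split_ifs with htr
      · rw [latT_of_lt (by omega)]
        exact smul_mem_latB _ _ _
      · exact mem_latT _)
    (fun t ht g hg => exists_sub_mem_latT (b := fun t => m t + l t) _ _ _ (by omega) hg)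
    (fun t ht g hg => by
      by_cases htr : t + 1 = r
      · subst htr
        rw [latT_of_lt (by omega)] at hg
        rw [latT_of_le le_rfl, hl]
        refine ⟨g.2, mem_latL.2 ⟨?_, ?_⟩⟩
        · simpa [mul_comm c] using mem_latB.1 hg
        · simp
      · simp only [if_neg htr]
        exact exists_sub_mem_latT (b := m) _ _ _ (by omega) hg)
  rcases hc with rfl | ⟨hr0, rfl⟩
  · left
    refine ⟨hl, α, β, hα, hβ, ?_, ?_⟩
    · ext g
      rw [h1]
      simp only [Set.mem_ofPred_eq, digitSum_special hr, toGHom_apply, forall_lt_ite_iff hr,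
        and_assoc]
      simp only [mul_zero, add_zero]
    · ext g
      rw [h2]
      simp only [Set.mem_ofPred_eq, digitSum_filter hr (fun _ => hβ 0), toGHom_apply, mul_zero,
        add_zero]
  · right
    refine ⟨hr0, α, β, hα, hβ, ?_, ?_⟩
    · ext g
      rw [h1]
      simp only [Set.mem_ofPred_eq, digitSum_special hr, toGHom_apply,
        forall_lt_ite_iff hr, and_assoc, hl, zero_add, pow_one]
    · ext g
      rw [h2]
      simp only [Set.mem_ofPred_eq, digitSum_filter hr (fun _ => hβ 0), toGHom_apply]

end Digits

/-! ### Levels as the successive elements of a set of positions -/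

section Levels

variable {k d : ℕ} {Q : ℕ → Prop}

theorem not_of_nth_lt_of_lt_nth (hQ : {p | Q p}.Infinite) {t p : ℕ}
    (h1 : ∀ s < t, Nat.nth Q s < p) (h2 : p < Nat.nth Q t) : ¬ Q p := by
  classical
  intro hp
  rw [← Nat.nth_count hp] at h2
  have h3 := (Nat.nth_lt_nth hQ).1 h2
  have := h1 _ h3
  rw [Nat.nth_count hp] at this
  exact lt_irrefl _ this

theorem count_sub_one [DecidablePred Q] (hd : 1 ≤ d) (hQd : Q (d - 1)) :
    Nat.count Q d - 1 = Nat.count Q (d - 1) := by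
  obtain ⟨d, rfl⟩ := Nat.exists_eq_add_of_le' hd
  rw [Nat.add_sub_cancel] at hQd ⊢
  rw [Nat.count_succ, if_pos hQd, Nat.add_sub_cancel]

/-- The elements of `Q` in increasing order, with `d` inserted at the index `r`. -/
noncomputable def insertLevel (Q : ℕ → Prop) (r d t : ℕ) : ℕ :=
  if t < r then Nat.nth Q t else if t = r then d else Nat.nth Q (t - 1)

theorem insertLevel_of_lt {r t : ℕ} (h : t < r) : insertLevel Q r d t = Nat.nth Q t := if_pos h

theorem insertLevel_self {r : ℕ} : insertLevel Q r d r = d := by simp [insertLevel]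

theorem insertLevel_of_gt {r t : ℕ} (h : r < t) :
    insertLevel Q r d t = Nat.nth Q (t - 1) := by
  rw [insertLevel, if_neg (by omega), if_neg (by omega)]

/-- For an exceptional step owned by `C`: the levels are the single steps of `S₀`, and `r` is the
last level below `d`. -/
theorem isLevelData_nth [DecidablePred Q] (hQ : {p | Q p}.Infinite) (hQk : Q k) (hQ0 : Q 0)
    (hd0 : 1 ≤ d) (hdk : d ≤ k) :
    IsLevelData k (Nat.count Q k) (Nat.count Q d - 1) (Nat.nth Q) fun _ => 1 := by
  have h1 : 1 ≤ Nat.count Q d := by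
    have := Nat.count_monotone Q hd0
    rwa [Nat.count_succ, Nat.count_zero, if_pos hQ0] at this
  have h2 := Nat.count_monotone Q hdk
  have hmono : StrictMono (Nat.nth Q) := Nat.nth_strictMono hQ
  refine ⟨by omega, ?_, Nat.nth_count hQk, fun t _ _ => ⟨hmono t.lt_succ_self, le_rfl⟩,
    fun t _ => hmono t.lt_succ_self⟩
  simpa using Nat.nth_count hQ0

/-- For an exceptional step owned by `S₀`: it becomes an extra level at `d` with `l_r = 0`. If `Q d`
holds, then `m_r = m_{r+1}`. -/
theorem isLevelData_insertLevel [DecidablePred Q] (hQ : {p | Q p}.Infinite) (hQk : Q k)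
    (hQ0 : 1 ≤ d → Q 0) (hdk : d ≤ k) :
    IsLevelData k (Nat.count Q k + 1) (Nat.count Q d) (insertLevel Q (Nat.count Q d) d)
      fun t => if t = Nat.count Q d then 0 else 1 := by
  have h2 := Nat.count_monotone Q hdk
  have hmono : StrictMono (Nat.nth Q) := Nat.nth_strictMono hQ
  have hnth : d ≤ Nat.nth Q (Nat.count Q d) := Nat.le_nth_count hQ d
  have hlt : ∀ t < Nat.count Q d, Nat.nth Q t < d := fun t ht => Nat.nth_lt_of_lt_count ht
  refine ⟨by omega, ?_, ?_, fun t ht htr => ⟨?_, by simp [htr]⟩, fun t ht => ?_⟩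
  · rcases Nat.eq_zero_or_pos d with rfl | hd
    · simp [insertLevel]
    · have h1 := Nat.count_monotone Q hd
      rw [Nat.count_succ, Nat.count_zero, if_pos (hQ0 hd)] at h1
      rw [insertLevel_of_lt (by omega)]
      simpa using Nat.nth_count (hQ0 hd)
  · rw [insertLevel_of_gt (by omega), Nat.add_sub_cancel, Nat.nth_count hQk]
  · rcases lt_trichotomy (t + 1) (Nat.count Q d) with h | h | h
    · rw [insertLevel_of_lt (by omega), insertLevel_of_lt h]
      exact hmono t.lt_succ_self
    · rw [insertLevel_of_lt (by omega), h, insertLevel_self]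
      exact hlt t (by omega)
    · rw [insertLevel_of_gt (by omega), insertLevel_of_gt h]
      exact hmono (by omega)
  · beta_reduce
    rcases lt_trichotomy (t + 1) (Nat.count Q d) with h | h | h
    · rw [insertLevel_of_lt (by omega), insertLevel_of_lt h, if_neg (by omega)]
      exact hmono t.lt_succ_self
    · rw [insertLevel_of_lt (by omega), h, insertLevel_self, if_neg (by omega)]
      exact hlt t (by omega)
    · rw [insertLevel_of_gt h]
      rcases (show t = Nat.count Q d ∨ Nat.count Q d < t by omega) with rfl | h'
      · rw [insertLevel_self, if_pos rfl]
        simpa using hnth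
      · rw [insertLevel_of_gt h', if_neg h'.ne']
        exact hmono (by omega)

end Levels

/-! ### Grouping the steps into levels -/

section Steps

variable {k d : ℕ} {c : ℤ} {Q : ℕ → Prop} {A C : Set (ℤ × ℤ)}

/-- All steps strictly between consecutive elements of `Q` belong to `C` and compose to one; at the
last level below `d` the composite includes the passage from `latB` to `latL`. -/
theorem steps_nth [DecidablePred Q] (hQ : {p | Q p}.Infinite) (hQ0 : Q 0) (hd0 : 1 ≤ d)
    (hB : ∀ p < d, Q p → StepBy A C (latB c p) (latB c (p + 1)))
    (hB' : ∀ p < d, ¬ Q p → StepBy C A (latB c p) (latB c (p + 1)))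
    (hL : ∀ p, d ≤ p → p < k → Q p → StepBy A C (latL p) (latL (p + 1)))
    (hL' : ∀ p, d ≤ p → ¬ Q p → StepBy C A (latL p) (latL (p + 1)))
    (hy : StepBy C A (latB c d) (latL d)) :
    ∀ t < Nat.count Q k,
      StepBy A C (latT c (Nat.count Q d - 1 + 1) (Nat.nth Q) t)
        (latT c (Nat.count Q d - 1 + 1) (fun t => Nat.nth Q t + 1) t) ∧
      StepBy C A (latT c (Nat.count Q d - 1 + 1) (fun t => Nat.nth Q t + 1) t)
        (latT c (Nat.count Q d - 1 + 1) (Nat.nth Q) (t + 1)) := by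
  have h1 : 1 ≤ Nat.count Q d := by
    have := Nat.count_monotone Q hd0
    rwa [Nat.count_succ, Nat.count_zero, if_pos hQ0] at this
  have hmono : StrictMono (Nat.nth Q) := Nat.nth_strictMono hQ
  have hnth : d ≤ Nat.nth Q (Nat.count Q d) := Nat.le_nth_count hQ d
  have hlt : ∀ t < Nat.count Q d, Nat.nth Q t < d := fun t ht => Nat.nth_lt_of_lt_count ht
  have hgap : ∀ t p, Nat.nth Q t + 1 ≤ p → p < Nat.nth Q (t + 1) → ¬ Q p := fun t p hp hp' =>
    not_of_nth_lt_of_lt_nth hQ (fun s hs => by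
      have := hmono.monotone (show s ≤ t by omega)
      omega) hp'
  intro t ht
  have htk : Nat.nth Q t < k := Nat.nth_lt_of_lt_count ht
  have hQt : Q (Nat.nth Q t) := Nat.nth_mem_of_infinite hQ t
  have hsucc : Nat.nth Q t + 1 ≤ Nat.nth Q (t + 1) := hmono t.lt_succ_self
  rw [Nat.sub_add_cancel h1]
  rcases lt_trichotomy (t + 1) (Nat.count Q d) with h | h | h
  · rw [latT_of_lt (by omega), latT_of_lt (by omega), latT_of_lt h]
    exact ⟨hB _ (hlt t (by omega)) hQt,
      StepBy.chain (latB c) hsucc fun s hs hs' =>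
        hB' s (by have := hlt _ h; omega) (hgap t s hs hs')⟩
  · rw [latT_of_lt (by omega), latT_of_lt (by omega), latT_of_le h.ge]
    have htd := hlt t (by omega)
    rw [← h] at hnth
    refine ⟨hB _ htd hQt, StepBy.trans (StepBy.trans ?_ hy) ?_⟩
    · exact StepBy.chain (latB c) htd fun s hs hs' => hB' s hs' (hgap t s hs (by omega))
    · exact StepBy.chain latL hnth fun s hs hs' => hL' s hs (hgap t s (by omega) hs')
  · have hdt : d ≤ Nat.nth Q t := hnth.trans (hmono.monotone (by omega))
    rw [latT_of_le (by omega), latT_of_le (by omega), latT_of_le h.le]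
    exact ⟨hL _ hdt htk hQt,
      StepBy.chain latL hsucc fun s hs hs' => hL' s (by omega) (hgap t s hs hs')⟩

theorem steps_insertLevel [DecidablePred Q] (hQ : {p | Q p}.Infinite)
    (hB : ∀ p < d, Q p → StepBy A C (latB c p) (latB c (p + 1)))
    (hB' : ∀ p < d, ¬ Q p → StepBy C A (latB c p) (latB c (p + 1)))
    (hL : ∀ p, d ≤ p → p < k → Q p → StepBy A C (latL p) (latL (p + 1)))
    (hL' : ∀ p, d ≤ p → ¬ Q p → StepBy C A (latL p) (latL (p + 1)))
    (hy : StepBy A C (latB c d) (latL d)) :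
    ∀ t < Nat.count Q k + 1,
      StepBy A C (latT c (Nat.count Q d + 1) (insertLevel Q (Nat.count Q d) d) t)
        (latT c (Nat.count Q d) (fun t => insertLevel Q (Nat.count Q d) d t +
          if t = Nat.count Q d then 0 else 1) t) ∧
      StepBy C A (latT c (Nat.count Q d) (fun t => insertLevel Q (Nat.count Q d) d t +
          if t = Nat.count Q d then 0 else 1) t)
        (latT c (Nat.count Q d + 1) (insertLevel Q (Nat.count Q d) d) (t + 1)) := by
  have hmono : StrictMono (Nat.nth Q) := Nat.nth_strictMono hQ
  have hnth : d ≤ Nat.nth Q (Nat.count Q d) := Nat.le_nth_count hQ d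
  have hlt : ∀ t < Nat.count Q d, Nat.nth Q t < d := fun t ht => Nat.nth_lt_of_lt_count ht
  have hgap : ∀ t p, Nat.nth Q t + 1 ≤ p → p < Nat.nth Q (t + 1) → ¬ Q p := fun t p hp hp' =>
    not_of_nth_lt_of_lt_nth hQ (fun s hs => by
      have := hmono.monotone (show s ≤ t by omega)
      omega) hp'
  intro t ht
  have hQt : ∀ t, Q (Nat.nth Q t) := Nat.nth_mem_of_infinite hQ
  rcases lt_trichotomy t (Nat.count Q d) with h | h | h
  · have htd := hlt t h
    rw [latT_of_lt (by omega), latT_of_lt h, latT_of_lt (by omega), if_neg h.ne,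
      insertLevel_of_lt h]
    refine ⟨hB _ htd (hQt t), ?_⟩
    rcases (show t + 1 < Nat.count Q d ∨ t + 1 = Nat.count Q d by omega) with h' | h'
    · rw [insertLevel_of_lt h']
      exact StepBy.chain (latB c) (hmono t.lt_succ_self) fun s hs hs' =>
        hB' s (by have := hlt _ h'; omega) (hgap t s hs hs')
    · rw [h', insertLevel_self]
      rw [← h'] at hnth
      exact StepBy.chain (latB c) htd fun s hs hs' => hB' s hs' (hgap t s hs (by omega))
  · subst h
    rw [latT_of_lt (by omega), latT_of_le le_rfl, latT_of_le le_rfl, if_pos rfl, insertLevel_self,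
      insertLevel_of_gt (Nat.lt_add_one _), add_zero, Nat.add_sub_cancel]
    exact ⟨hy, StepBy.chain latL hnth fun s hs hs' =>
      hL' s hs (not_of_nth_lt_of_lt_nth hQ (fun s' h => by have := hlt s' h; omega) hs')⟩
  · obtain ⟨t, rfl⟩ := Nat.exists_eq_add_of_le' (show 1 ≤ t by omega)
    have hdt : d ≤ Nat.nth Q t := hnth.trans (hmono.monotone (by omega))
    rw [latT_of_le (by omega), latT_of_le (by omega), latT_of_le (by omega), if_neg (by omega),
      insertLevel_of_gt h, insertLevel_of_gt (by omega), Nat.add_sub_cancel, Nat.add_sub_cancel]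
    exact ⟨hL _ hdt (Nat.nth_lt_of_lt_count (by omega)) (hQt t),
      StepBy.chain latL (hmono t.lt_succ_self) fun s hs hs' => hL' s (by omega) (hgap t s hs hs')⟩

end Steps

/-! ### From a tiling to a family -/

section Main

variable {k : ℕ} {S C : Set (ZMod (2 ^ k) × ZMod 2)}

/-- A generating set is not contained in a proper subgroup. -/
theorem eq_top_of_rigid (hgen : AddSubgroup.closure S = ⊤) {H : AddSubgroup (ℤ × ℤ)}
    (hH : latL k ≤ H) (hR : Rigid (toGHom k ⁻¹' (S ∪ {0})) ⊤ H) : H = ⊤ := by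
  have h1 : AddSubgroup.closure S ≤ H.map (toGHom k) := by
    rw [AddSubgroup.closure_le]
    intro s hs
    obtain ⟨a, rfl⟩ := toGHom_surjective k s
    exact ⟨a, by simpa using hR a (Or.inl hs) 0 (by simp) trivial, rfl⟩
  rw [hgen] at h1
  refine eq_top_iff.2 fun g _ => ?_
  obtain ⟨h, hh, hg⟩ := h1 (AddSubgroup.mem_top (toGHom k g))
  have := H.add_mem (hH (toGHom_eq_iff.1 hg.symm)) hh
  simpa using this

theorem exists_family_of_tilesMod (hgen : AddSubgroup.closure S = ⊤) (hC0 : 0 ∈ C)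
    (hT : TilesMod (latL k) (toGHom k ⁻¹' (S ∪ {0})) (toGHom k ⁻¹' C)) :
    ∃ (n r : ℕ) (m l : ℕ → ℕ), IsLevelData k n r m l ∧
      (FamilyB k n r m l (S ∪ {0}) C ∨ FamilyC k n r m l (S ∪ {0}) C ∨
        FamilyD k n r m l (S ∪ {0}) C ∨ FamilyE k n r m l (S ∪ {0}) C) := by
  classical
  have hS0 : (0 : ZMod (2 ^ k) × ZMod 2) ∈ S ∪ {0} := by simp
  obtain ⟨d, hdk, c, hc, hstepB, hy, hstepL⟩ := hT.exists_steps
  have hgenA := fun {H : AddSubgroup (ℤ × ℤ)} => eq_top_of_rigid (H := H) hgen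
  set A := toGHom k ⁻¹' (S ∪ {0})
  set B := toGHom k ⁻¹' C
  -- The positions of the steps of `S₀`. All `p ≥ k` are added so that `Q` is infinite and the last
  -- level `m_n` is `k`.
  let Q : ℕ → Prop := fun p => k ≤ p ∨ (p < d ∧ StepBy A B (latB c p) (latB c (p + 1))) ∨
    (d ≤ p ∧ StepBy A B (latL p) (latL (p + 1)))
  have hQk : ∀ p, k ≤ p → Q p := fun p hp => Or.inl hp
  have hQ : {p | Q p}.Infinite :=
    Set.infinite_of_not_bddAbove fun ⟨b, hb⟩ => by
      have := hb (hQk (k + b + 1) (by omega))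
      omega
  have hB : ∀ p < d, Q p → StepBy A B (latB c p) (latB c (p + 1)) := by
    rintro p hp (h | h | h)
    · omega
    · exact h.2
    · omega
  have hL : ∀ p, d ≤ p → p < k → Q p → StepBy A B (latL p) (latL (p + 1)) := by
    rintro p hp hpk (h | h | h)
    · omega
    · omega
    · exact h.2
  have hB' : ∀ p < d, ¬ Q p → StepBy B A (latB c p) (latB c (p + 1)) := fun p hp hQp =>
    (hstepB p hp).resolve_left fun h => hQp (Or.inr (Or.inl ⟨hp, h⟩))
  have hL' : ∀ p, d ≤ p → ¬ Q p → StepBy B A (latL p) (latL (p + 1)) := fun p hp hQp =>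
    (hstepL p hp (not_le.1 fun h => hQp (Or.inl h))).resolve_left
      fun h => hQp (Or.inr (Or.inr ⟨hp, h⟩))
  have hcd : (2 : ℤ) ^ d ∣ 2 * c := by
    rcases hc with rfl | ⟨hd, rfl, -⟩
    · simp
    · rw [← pow_succ', Nat.sub_add_cancel hd]
  -- If the first step belonged to `C`, then `S₀` would lie in the proper subgroup `latB c 1`,
  -- against generation.
  have hQ0 : 1 ≤ d → Q 0 := by
    intro hd
    by_contra h0
    have h1 := (hB' 0 hd h0).2
    rw [latB_zero] at h1
    have h2 : ((1, 0) : ℤ × ℤ) ∈ latB c 1 := by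
      rw [hgenA (latL_le_latB ((pow_dvd_pow 2 hd).trans hcd) (hd.trans hdk)) h1]
      trivial
    simp [mem_latB] at h2
  rcases hy with hy | hy
  · have hlev := isLevelData_insertLevel hQ (hQk k le_rfl) hQ0 hdk
    have hsteps := steps_insertLevel hQ hB hB' hL hL' hy
    refine ⟨_, _, _, _, hlev, Or.inr (Or.inr ?_)⟩
    refine exists_familyD_or_familyE hlev hS0 hC0 (if_pos rfl) (c := c) ?_
      (fun t ht => (hsteps t ht).1) fun t ht => (hsteps t ht).2
    rw [insertLevel_self]
    refine hc.imp_right fun ⟨hd, hc, _⟩ => ⟨?_, hc⟩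
    have := Nat.count_monotone Q hd
    rwa [Nat.count_succ, Nat.count_zero, if_pos (hQ0 hd)] at this
  -- For `d = 0` all second coordinates in `S₀` would be even, again against generation.
  · have hd : 1 ≤ d := by
      by_contra h0
      obtain rfl : d = 0 := by omega
      have h1 := hy.2
      rw [latB_zero] at h1
      have h2 : ((0, 1) : ℤ × ℤ) ∈ latL 0 := by
        rw [hgenA (latL_anti (Nat.zero_le k)) h1]
        trivial
      have h3 : (2 : ℤ) ∣ 1 := (mem_latL.1 h2).2
      omega
    have hlev := isLevelData_nth hQ (hQk k le_rfl) (hQ0 hd) hd hdk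
    have hsteps := steps_nth hQ (hQ0 hd) hd hB hB' hL hL' hy
    have hm : Nat.nth Q (Nat.count Q d - 1) < Nat.nth Q (Nat.count Q d - 1 + 1) :=
      Nat.nth_strictMono hQ (Nat.lt_succ_self (Nat.count Q d - 1))
    refine ⟨_, _, _, _, hlev, ?_⟩
    rcases hc with rfl | ⟨-, rfl, -, hnot⟩
    · exact Or.inr (Or.inl (exists_familyC hlev hS0 hC0 hm (fun t ht => (hsteps t ht).1)
        fun t ht => (hsteps t ht).2))
    · left
      -- Otherwise `C` would own both steps from `latB c (d - 1)` to `latL d`, hence the step from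
      -- the smaller `latL (d - 1)`, which the choice of `d` excludes. Thus `m_r = d - 1`, and `c =
      -- 2 ^ (m_r + l_r - 1)` as family (b) demands.
      have hQd : Q (d - 1) := by
        by_contra h
        have h1 := hB' (d - 1) (by omega) h
        rw [Nat.sub_add_cancel hd] at h1
        have h2 := h1.1.trans hy.1
        exact hnot fun a ha g hg => h2 a ha g
          (latL_le_latB ((pow_dvd_pow 2 (Nat.sub_le d 1)).trans hcd) le_rfl hg)
      have hmd : Nat.nth Q (Nat.count Q d - 1) = d - 1 := by
        rw [count_sub_one hd hQd, Nat.nth_count hQd]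
      refine exists_familyB hlev hS0 hC0 hm (by omega) ?_ ?_
      · rw [hmd, Nat.sub_add_cancel hd]
        exact fun t ht => (hsteps t ht).1
      · rw [hmd, Nat.sub_add_cancel hd]
        exact fun t ht => (hsteps t ht).2

end Main

theorem mainTheorem7 (k : ℕ) (hk : 1 ≤ k)
    (S : Set (ZMod (2 ^ k) × ZMod 2)) (hS : S ⊂ {0}ᶜ)
    (hgen : AddSubgroup.closure S = ⊤)
    (C : Set (ZMod (2 ^ k) × ZMod 2)) (hC : (0 : ZMod (2 ^ k) × ZMod 2) ∈ C) :
    IsPerfectCode (cayleyDigraph S) C ↔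
      ∃ (n r : ℕ) (m l : ℕ → ℕ), IsLevelData k n r m l ∧
        (FamilyA k n r m l (S ∪ {0}) C ∨ FamilyB k n r m l (S ∪ {0}) C ∨
          FamilyC k n r m l (S ∪ {0}) C ∨ FamilyD k n r m l (S ∪ {0}) C ∨
          FamilyE k n r m l (S ∪ {0}) C ∨ FamilyF k n r m l (S ∪ {0}) C) := by
  rw [isPerfectCode_iff_tilesMod]
  have hS0 : (0 : ZMod (2 ^ k) × ZMod 2) ∈ S ∪ {0} := by simp
  constructor
  · intro hT
    obtain ⟨n, r, m, l, h, H⟩ := exists_family_of_tilesMod hgen hC hT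
    exact ⟨n, r, m, l, h, by tauto⟩
  · rintro ⟨n, r, m, l, h, H | H | H | H | H | H⟩
    · exact H.tilesMod h hS0 hC
    · exact H.tilesMod h hS0 hC
    · exact H.tilesMod h hS0 hC
    · exact H.tilesMod h hS0 hC
    · exact H.tilesMod h hS0 hC
    · exact H.tilesMod h hS0 hC
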